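/- Let $0<s<1$, let $1\le q\le p<\infty$, let $d\ge 1$ be an integer, and let $\alpha,\beta\in\mathbb{R}$ satisfy $$\alpha<sq-\left(1-\tfrac{q}{p}\right)d,\qquad \beta<sp,\qquad \alpha>-d,\qquad \beta>-d,\qquad \alpha+\tfrac{q\beta}{p}>-d .$$ Put $$\mathcal{C}=\left(\int_{0}^{1}t^{sp-1}\left(t^{-\left(\frac{p}{q}-1\right)d-\frac{p\alpha}{q}}+t^{-\beta}\right)\left|1-t^{\left(d+\alpha+\frac{q\beta}{p}-sq\right)/q}\right|^p\Phi_{d,s,p}(t)\,dt\right)^{\frac{q}{p}},$$ where, for $0<t<1$, $$\Phi_{d,s,p}(t)=\begin{cases}\displaystyle\omega_{d-2}\int_{-1}^{1}\frac{(1-r^{2})^{\frac{d-3}{2}}}{(1-2tr+t^2)^{\frac{d+sp}{2}}}\,dr, & d\ge 2,\\[2mm] (1-t)^{-1-sp}+(1+t)^{-1-sp}, & d=1,\end{cases}\qquad \omega_{n}=\frac{2\pi^{(n+1)/2}}{\Gamma\left((n+1)/2\right)} .$$ Then $\mathcal{C}<\infty$. Consider the inequality $$\int_{\mathbb{R}^d}\left(\int_{\mathbb{R}^d}\frac{|u(x)-u(y)|^p}{|x-y|^{d+sp}}|y|^{\beta}\,dy\right)^{\frac{q}{p}}|x|^{\alpha}\,dx\;\ge\;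 \mathcal{C}\int_{\mathbb{R}^d}\frac{|u(x)|^q}{|x|^{sq-\alpha-\frac{q\beta}{p}}}\,dx. \qquad (*)$$ If $sq-\alpha-\frac{q\beta}{p}<d$, then $(*)$ holds for all real-valued $u\in C_c^1(\mathbb{R}^d)$, and $\mathcal{C}$ is sharp: it is the largest constant for which $(*)$ holds for all such $u$. If $sq-\alpha-\frac{q\beta}{p}>d$, then $(*)$ holds for all real-valued $u\in C_c^1(\mathbb{R}^d\setminus\{0\})$, and $\mathcal{C}$ is sharp in the same sense for this class. -/

import Mathlib

open MeasureTheory Set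
open scoped ENNReal

noncomputable section

/-- The surface measure `ω_n = 2 π^((n+1)/2) / Γ((n+1)/2)` of the unit sphere `𝕊^n ⊂ ℝ^(n+1)`. -/
def sphereArea (n : ℝ) : ℝ :=
  2 * Real.pi ^ ((n + 1) / 2) / Real.Gamma ((n + 1) / 2)

/-- The kernel `Φ_{d,s,p}(t)`, used for `0 < t < 1`. -/
def Phi (d : ℕ) (s p t : ℝ) : ℝ≥0∞ :=
  if d = 1 then
    ENNReal.ofReal ((1 - t) ^ (-1 - s * p) + (1 + t) ^ (-1 - s * p))
  else
    ENNReal.ofReal (sphereArea ((d : ℝ) - 2)) *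
      ∫⁻ r in Ioo (-1 : ℝ) 1,
        ENNReal.ofReal ((1 - r ^ 2) ^ (((d : ℝ) - 3) / 2) /
          (1 - 2 * t * r + t ^ 2) ^ (((d : ℝ) + s * p) / 2))

/-- The constant `C^{p,q}_{d,s,α,β}`. -/
def hardyConst (d : ℕ) (s p q α β : ℝ) : ℝ≥0∞ :=
  (∫⁻ t in Ioo (0 : ℝ) 1,
    ENNReal.ofReal (t ^ (s * p - 1) *
        (t ^ (-(p / q - 1) * (d : ℝ) - p * α / q) + t ^ (-β)) *
        |1 - t ^ (((d : ℝ) + α + q * β / p - s * q) / q)| ^ p) *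
      Phi d s p t) ^ (q / p)

/-- The weighted Triebel–Lizorkin seminorm
`∫ (∫ |u(x) - u(y)|^p / |x - y|^(d+sp) |y|^β dy)^(q/p) |x|^α dx`, with values in `[0, ∞]`. -/
def triebelLizorkin (d : ℕ) (s p q α β : ℝ) (u : EuclideanSpace ℝ (Fin d) → ℝ) : ℝ≥0∞ :=
  ∫⁻ x : EuclideanSpace ℝ (Fin d),
    (∫⁻ y : EuclideanSpace ℝ (Fin d),
      ENNReal.ofReal (|u x - u y| ^ p / ‖x - y‖ ^ ((d : ℝ) + s * p) * ‖y‖ ^ β)) ^ (q / p) *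
    ENNReal.ofReal (‖x‖ ^ α)

/-- The Hardy integral `∫ |u(x)|^q / |x|^(sq - α - qβ/p) dx`, with values in `[0, ∞]`. -/
def hardyIntegral (d : ℕ) (s p q α β : ℝ) (u : EuclideanSpace ℝ (Fin d) → ℝ) : ℝ≥0∞ :=
  ∫⁻ x : EuclideanSpace ℝ (Fin d),
    ENNReal.ofReal (|u x| ^ q / ‖x‖ ^ (s * q - α - q * β / p))

/-- The class `C_c^1(U)` for an open set `U ⊆ ℝ^d`, its members being extended by zero to `ℝ^d`. -/
def CcOne (d : ℕ) (U : Set (EuclideanSpace ℝ (Fin d))) :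
    Set (EuclideanSpace ℝ (Fin d) → ℝ) :=
  {u | ContDiff ℝ 1 u ∧ HasCompactSupport u ∧ tsupport u ⊆ U}

/-- The weighted Hardy inequality with constant `c` on the class `F` of functions. -/
def HardyInequality (d : ℕ) (s p q α β : ℝ) (F : Set (EuclideanSpace ℝ (Fin d) → ℝ))
    (c : ℝ≥0∞) : Prop :=
  ∀ u ∈ F, c * hardyIntegral d s p q α β u ≤ triebelLizorkin d s p q α β u

end

section Radial

variable {E : Type*} [NormedAddCommGroup E] [NormedSpace ℝ E] [FiniteDimensional ℝ E]
  [MeasurableSpace E] [BorelSpace E] (μ : Measure E) [μ.IsAddHaarMeasure]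

/-- Polar coordinates for the Lebesgue integral of a radial function. -/
lemma lintegral_fun_norm_addHaar [Nontrivial E] {f : ℝ → ℝ≥0∞} (hf : Measurable f) :
    ∫⁻ x, f ‖x‖ ∂μ = (Module.finrank ℝ E * μ (Metric.ball 0 1)) *
      ∫⁻ r in Ioi (0 : ℝ), ENNReal.ofReal (r ^ (Module.finrank ℝ E - 1)) * f r := by
  have h1 : ∫⁻ x, f ‖x‖ ∂μ = ∫⁻ x : ({(0)}ᶜ : Set E), f ‖x.1‖ ∂(μ.comap (↑)) := by
    rw [lintegral_subtype_comap (measurableSet_singleton _).compl fun x ↦ f ‖x‖,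
      restrict_compl_singleton]
  have hf2 : Measurable fun x : Ioi (0 : ℝ) ↦ f x := hf.comp measurable_subtype_coe
  have h2 : ∫⁻ x : ({(0)}ᶜ : Set E), f ‖x.1‖ ∂(μ.comap (↑)) =
      ∫⁻ x, f x.2 ∂μ.toSphere.prod (.volumeIoiPow (Module.finrank ℝ E - 1)) := by
    rw [← μ.measurePreserving_homeomorphUnitSphereProd.lintegral_comp
      (show Measurable fun x : Metric.sphere (0 : E) 1 × Ioi (0 : ℝ) ↦ f x.2 from
        hf2.comp measurable_snd)]
    simp
  rw [h1, h2, lintegral_prod _ (show Measurable fun x : Metric.sphere (0 : E) 1 × Ioi (0 : ℝ) ↦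
    f x.2 from hf2.comp measurable_snd).aemeasurable]
  simp only [lintegral_const, Measure.toSphere_apply_univ]
  rw [mul_comm, Measure.volumeIoiPow, lintegral_withDensity_eq_lintegral_mul _ _ hf2]
  · rw [← lintegral_subtype_comap measurableSet_Ioi]
    rfl
  · fun_prop

lemma lintegral_comp_smul_of_pos {c : ℝ} (hc : 0 < c) (f : E → ℝ≥0∞) :
    ∫⁻ x, f (c • x) ∂μ = ENNReal.ofReal (c ^ (-(Module.finrank ℝ E : ℝ))) * ∫⁻ x, f x ∂μ := by
  have h := Measure.map_addHaar_smul μ hc.ne'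
  have h2 : ∫⁻ x, f (c • x) ∂μ = ∫⁻ x, f x ∂(Measure.map (c • ·) μ) :=
    ((Homeomorph.smulOfNeZero c hc.ne').toMeasurableEquiv.measurableEmbedding.lintegral_map f).symm
  rw [h2, h, lintegral_smul_measure, smul_eq_mul, abs_of_pos (by positivity), Real.rpow_neg hc.le,
    Real.rpow_natCast]

end Radial

section Powers

variable {d : ℕ}

local notation "𝔼" => EuclideanSpace ℝ (Fin d)

lemma nontrivial_euclideanSpace (hd : 1 ≤ d) : Nontrivial 𝔼 := by
  have : Nonempty (Fin d) := ⟨⟨0, hd⟩⟩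
  infer_instance

/-- The surface area of the unit sphere of `ℝ^d`, as an extended number. -/
noncomputable def sphereMass (d : ℕ) : ℝ≥0∞ :=
  d * volume (Metric.ball (0 : EuclideanSpace ℝ (Fin d)) 1)

lemma sphereMass_ne_zero (hd : 1 ≤ d) : sphereMass d ≠ 0 := by
  rw [sphereMass]
  refine mul_ne_zero (by simpa using (by omega : d ≠ 0)) ?_
  exact (Metric.measure_ball_pos _ _ one_pos).ne'

lemma sphereMass_ne_top : sphereMass d ≠ ∞ :=
  ENNReal.mul_ne_top (by simp) measure_ball_lt_top.ne

lemma lintegral_norm_euclideanSpace (hd : 1 ≤ d) {f : ℝ → ℝ≥0∞} (hf : Measurable f) :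
    ∫⁻ x : 𝔼, f ‖x‖ = sphereMass d *
      ∫⁻ r in Ioi (0 : ℝ), ENNReal.ofReal (r ^ ((d : ℝ) - 1)) * f r := by
  have := nontrivial_euclideanSpace hd
  rw [lintegral_fun_norm_addHaar volume hf, finrank_euclideanSpace_fin, sphereMass]
  congr 1
  refine setLIntegral_congr_fun measurableSet_Ioi fun r _ ↦ ?_
  rw [← Real.rpow_natCast, Nat.cast_sub hd, Nat.cast_one]

lemma setLIntegral_rpow_norm_lt_top (hd : 1 ≤ d) {η : ℝ} {S : Set ℝ} (hS : MeasurableSet S)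
    (h : IntegrableOn (fun r : ℝ ↦ r ^ ((d : ℝ) - 1 + η)) (Ioi 0 ∩ S)) :
    ∫⁻ x : 𝔼 in {x | ‖x‖ ∈ S}, ENNReal.ofReal (‖x‖ ^ η) < ∞ := by
  have hm : MeasurableSet {x : 𝔼 | ‖x‖ ∈ S} := measurable_norm hS
  rw [← lintegral_indicator hm]
  have h1 : ∀ x : 𝔼, {x : 𝔼 | ‖x‖ ∈ S}.indicator (fun x ↦ ENNReal.ofReal (‖x‖ ^ η)) x =
      S.indicator (fun r ↦ ENNReal.ofReal (r ^ η)) ‖x‖ := fun x ↦ by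
    simp [indicator]
  simp_rw [h1]
  rw [lintegral_norm_euclideanSpace hd ((by fun_prop : Measurable _).indicator hS)]
  refine ENNReal.mul_lt_top sphereMass_ne_top.lt_top ?_
  have h2 : ∫⁻ r in Ioi (0 : ℝ), ENNReal.ofReal (r ^ ((d : ℝ) - 1)) *
      S.indicator (fun r ↦ ENNReal.ofReal (r ^ η)) r =
      ∫⁻ r in Ioi 0 ∩ S, ENNReal.ofReal (r ^ ((d : ℝ) - 1 + η)) := by
    rw [inter_comm, ← setLIntegral_indicator hS]
    refine setLIntegral_congr_fun measurableSet_Ioi fun r hr ↦ ?_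
    by_cases hrS : r ∈ S
    · simp only [hrS, indicator_of_mem]
      rw [← ENNReal.ofReal_mul (Real.rpow_nonneg (le_of_lt hr) _), Real.rpow_add hr]
    · simp [hrS]
  rw [h2]
  have h3 := h.2
  refine lt_of_le_of_lt (lintegral_mono fun r ↦ ?_) h3
  exact Real.ofReal_le_enorm _

lemma setLIntegral_ball_rpow_norm_lt_top (hd : 1 ≤ d) {η : ℝ} (hη : -(d : ℝ) < η) (R : ℝ) :
    ∫⁻ x : 𝔼 in {x | ‖x‖ ∈ Iio R}, ENNReal.ofReal (‖x‖ ^ η) < ∞ := by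
  refine setLIntegral_rpow_norm_lt_top hd measurableSet_Iio ?_
  rw [Ioi_inter_Iio]
  by_cases hR : 0 < R
  · rw [intervalIntegral.integrableOn_Ioo_rpow_iff hR]
    linarith
  · simp [Ioo_eq_empty hR]

lemma setLIntegral_compl_ball_rpow_norm_lt_top (hd : 1 ≤ d) {η : ℝ} (hη : η < -(d : ℝ)) {R : ℝ}
    (hR : 0 < R) :
    ∫⁻ x : 𝔼 in {x | ‖x‖ ∈ Ioi R}, ENNReal.ofReal (‖x‖ ^ η) < ∞ := by
  refine setLIntegral_rpow_norm_lt_top hd measurableSet_Ioi ?_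
  rw [Ioi_inter_Ioi, sup_of_le_right hR.le]
  exact integrableOn_Ioi_rpow_of_lt (by linarith) hR

end Powers

section Rotations

variable {d : ℕ}

local notation "𝔼" => EuclideanSpace ℝ (Fin d)

/-- The orthogonal group of `ℝ^d`. -/
abbrev OrthGroup (d : ℕ) : Type :=
  unitary (EuclideanSpace ℝ (Fin d) →L[ℝ] EuclideanSpace ℝ (Fin d))

/-- The action of an orthogonal transformation on a vector. -/
noncomputable def OrthGroup.act (g : OrthGroup d) (x : 𝔼) : 𝔼 :=
  (g : 𝔼 →L[ℝ] 𝔼) x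

namespace OrthGroup

lemma norm_act (g : OrthGroup d) (x : 𝔼) : ‖g.act x‖ = ‖x‖ := Unitary.norm_map g x

lemma act_smul (g : OrthGroup d) (c : ℝ) (x : 𝔼) : g.act (c • x) = c • g.act x :=
  map_smul (g : 𝔼 →L[ℝ] 𝔼) c x

lemma act_sub (g : OrthGroup d) (x y : 𝔼) : g.act (x - y) = g.act x - g.act y :=
  map_sub (g : 𝔼 →L[ℝ] 𝔼) x y

lemma mul_act (g k : OrthGroup d) (x : 𝔼) : (g * k).act x = g.act (k.act x) := rfl

lemma continuous_act : Continuous fun z : 𝔼 × OrthGroup d ↦ z.2.act z.1 := by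
  unfold act
  fun_prop

lemma measurePreserving_act (g : OrthGroup d) : MeasurePreserving (g.act : 𝔼 → 𝔼) :=
  (Unitary.linearIsometryEquiv g).measurePreserving

lemma lintegral_act (g : OrthGroup d) (f : 𝔼 → ℝ≥0∞) : ∫⁻ x, f (g.act x) = ∫⁻ x, f x :=
  (measurePreserving_act g).lintegral_comp_emb
    (Unitary.linearIsometryEquiv g).toHomeomorph.measurableEmbedding f

lemma exists_act_eq {x y : 𝔼} (h : ‖x‖ = ‖y‖) : ∃ k : OrthGroup d, k.act x = y :=
  ⟨Unitary.linearIsometryEquiv.symm (Submodule.reflection (ℝ ∙ (x - y))ᗮ),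
    Submodule.reflection_sub h⟩

instance : ContinuousStar (𝔼 →L[ℝ] 𝔼) where
  continuous_star := ContinuousLinearMap.adjoint.continuous

instance : CompactSpace (OrthGroup d) := by
  suffices h : IsCompact (unitary (𝔼 →L[ℝ] 𝔼) : Set (𝔼 →L[ℝ] 𝔼)) from
    isCompact_iff_compactSpace.1 h
  have : ProperSpace (𝔼 →L[ℝ] 𝔼) := FiniteDimensional.proper ℝ _
  refine Metric.isCompact_of_isClosed_isBounded isClosed_unitary ?_
  refine (Metric.isBounded_closedBall (x := (0 : 𝔼 →L[ℝ] 𝔼)) (r := 1)).subset fun g hg ↦ ?_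
  rw [mem_closedBall_zero_iff]
  refine ContinuousLinearMap.opNorm_le_bound _ zero_le_one fun x ↦ ?_
  rw [one_mul]
  exact (norm_act ⟨g, hg⟩ x).le

instance : SecondCountableTopology (OrthGroup d) := by
  have : ProperSpace (𝔼 →L[ℝ] 𝔼) := FiniteDimensional.proper ℝ _
  infer_instance

lemma measurable_act : Measurable fun z : 𝔼 × OrthGroup d ↦ z.2.act z.1 :=
  continuous_act.measurable

/-- The right-invariant probability measure on the orthogonal group. -/
noncomputable def haar (d : ℕ) : Measure (OrthGroup d) :=
  (Measure.haarMeasure (⊤ : TopologicalSpace.PositiveCompacts (OrthGroup d))).inv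

instance : IsProbabilityMeasure (haar d) where
  measure_univ := by
    rw [haar, Measure.inv_apply, Set.inv_univ]
    exact Measure.haarMeasure_self

instance : (haar d).IsMulRightInvariant := by
  unfold haar
  infer_instance

lemma lintegral_haar_mul_right (k : OrthGroup d) (f : OrthGroup d → ℝ≥0∞) :
    ∫⁻ g, f (g * k) ∂haar d = ∫⁻ g, f g ∂haar d :=
  lintegral_mul_right_eq_self f k

/-- Averaging a Lebesgue integral over rotations of a unit vector. -/
lemma lintegral_average {v : 𝔼} (hv : ‖v‖ = 1) {A : 𝔼 → ℝ≥0∞} (hA : Measurable A) :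
    ∫⁻ x : 𝔼, ∫⁻ g : OrthGroup d, A (‖x‖ • g.act v) ∂haar d = ∫⁻ x, A x := by
  have h1 : ∫⁻ x, A x = ∫⁻ g : OrthGroup d, (∫⁻ x, A (g.act x)) ∂haar d := by
    simp [lintegral_act]
  rw [h1, ← lintegral_lintegral_swap (f := fun (x : 𝔼) (g : OrthGroup d) ↦ A (g.act x))
    (hA.comp measurable_act).aemeasurable]
  refine lintegral_congr fun x ↦ ?_
  obtain ⟨k, hk⟩ := exists_act_eq (x := ‖x‖ • v) (y := x) (by simp [norm_smul, hv])
  simp_rw [← act_smul]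
  rw [← lintegral_haar_mul_right k fun g ↦ A (g.act (‖x‖ • v))]
  refine lintegral_congr fun g ↦ ?_
  rw [mul_act, hk]

lemma lintegral_average_of_ne_zero {v : 𝔼} (hv : v ≠ 0) {A : 𝔼 → ℝ≥0∞} (hA : Measurable A) :
    ∫⁻ x : 𝔼, ∫⁻ g : OrthGroup d, A (‖x‖ • g.act v) ∂haar d =
      ENNReal.ofReal (‖v‖ ^ (-(d : ℝ))) * ∫⁻ x, A x := by
  have hv' : 0 < ‖v‖ := norm_pos_iff.2 hv
  have h1 : ‖(‖v‖⁻¹ • v)‖ = 1 := by simp [norm_smul, hv'.ne']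
  have h2 := lintegral_comp_smul_of_pos (volume : Measure 𝔼) hv'
    (fun x ↦ ∫⁻ g : OrthGroup d, A (‖x‖ • g.act (‖v‖⁻¹ • v)) ∂haar d)
  rw [lintegral_average h1 hA, finrank_euclideanSpace_fin] at h2
  rw [← h2]
  refine lintegral_congr fun x ↦ lintegral_congr fun g ↦ ?_
  rw [act_smul, norm_smul, norm_norm, smul_smul]
  congr 2
  field_simp

end OrthGroup

end Rotations

section Finiteness

variable {d : ℕ}

local notation "𝔼" => EuclideanSpace ℝ (Fin d)

lemma abs_log_le_two_mul_abs_sub_one {t : ℝ} (ht : 1 / 2 ≤ t) : |Real.log t| ≤ 2 * |t - 1| := by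
  have h0 : 0 < t := by linarith
  have h1 := Real.log_le_sub_one_of_pos h0
  have h2 := Real.one_sub_inv_le_log_of_pos h0
  rw [abs_le]
  constructor
  · rcases le_total 1 t with h | h
    · have := Real.log_nonneg h
      have := abs_nonneg (t - 1)
      linarith
    · rw [abs_of_nonpos (by linarith)]
      have : t⁻¹ - 1 ≤ 2 * (1 - t) := by
        have h3 : t⁻¹ - 1 = t⁻¹ * (1 - t) := by field_simp
        have h4 : t⁻¹ ≤ 2 := by
          rw [inv_le_comm₀ h0 (by norm_num)]
          linarith
        rw [h3]
        exact mul_le_mul_of_nonneg_right h4 (by linarith)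
      linarith
  · have := le_abs_self (t - 1)
    have := abs_nonneg (t - 1)
    linarith

/-- The function controlling all the integrands near the singular sphere `‖z‖ = 1`. -/
noncomputable def logWeight (d : ℕ) (σ p η : ℝ) (e z : EuclideanSpace ℝ (Fin d)) : ℝ :=
  min 1 |Real.log ‖z‖| ^ p * ‖z‖ ^ η / ‖e - z‖ ^ ((d : ℝ) + σ)

lemma logWeight_le_of_norm_lt {σ p η : ℝ} (hσ : 0 < σ) (hp : 0 ≤ p) {e z : 𝔼} (he : ‖e‖ = 1)
    (hz : ‖z‖ < 1 / 2) :
    logWeight d σ p η e z ≤ 2 ^ ((d : ℝ) + σ) * ‖z‖ ^ η := by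
  have h1 : 1 / 2 ≤ ‖e - z‖ := by
    have := norm_sub_norm_le e z
    linarith
  have h2 : min 1 |Real.log ‖z‖| ^ p ≤ 1 :=
    Real.rpow_le_one (by positivity) (min_le_left _ _) hp
  have h3 : (1 / 2 : ℝ) ^ ((d : ℝ) + σ) ≤ ‖e - z‖ ^ ((d : ℝ) + σ) :=
    Real.rpow_le_rpow (by norm_num) h1 (by positivity)
  rw [logWeight]
  calc min 1 |Real.log ‖z‖| ^ p * ‖z‖ ^ η / ‖e - z‖ ^ ((d : ℝ) + σ)
      ≤ 1 * ‖z‖ ^ η / (1 / 2 : ℝ) ^ ((d : ℝ) + σ) := by gcongr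
    _ = _ := by
      rw [one_div, Real.inv_rpow (by norm_num)]
      field_simp

lemma logWeight_le_of_lt_norm {σ p η : ℝ} (hσ : 0 < σ) (hp : 0 ≤ p) {e z : 𝔼} (he : ‖e‖ = 1)
    (hz : 2 < ‖z‖) :
    logWeight d σ p η e z ≤ 2 ^ ((d : ℝ) + σ) * ‖z‖ ^ (η - ((d : ℝ) + σ)) := by
  have h1 : ‖z‖ / 2 ≤ ‖e - z‖ := by
    have := norm_sub_norm_le z e
    rw [norm_sub_rev] at this
    linarith
  have h2 : min 1 |Real.log ‖z‖| ^ p ≤ 1 :=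
    Real.rpow_le_one (by positivity) (min_le_left _ _) hp
  have h0 : 0 < ‖z‖ := by linarith
  have h3 : (‖z‖ / 2 : ℝ) ^ ((d : ℝ) + σ) ≤ ‖e - z‖ ^ ((d : ℝ) + σ) :=
    Real.rpow_le_rpow (by positivity) h1 (by positivity)
  rw [logWeight]
  calc min 1 |Real.log ‖z‖| ^ p * ‖z‖ ^ η / ‖e - z‖ ^ ((d : ℝ) + σ)
      ≤ 1 * ‖z‖ ^ η / (‖z‖ / 2 : ℝ) ^ ((d : ℝ) + σ) := by gcongr
    _ = _ := by
      rw [Real.div_rpow h0.le (by norm_num), Real.rpow_sub h0]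
      field_simp

lemma logWeight_le_of_norm_mem {σ p η : ℝ} (hσ : 0 < σ) (hp : 0 ≤ p) {e z : 𝔼} (he : ‖e‖ = 1)
    (hz : ‖z‖ ∈ Icc (1 / 2) 2) :
    logWeight d σ p η e z ≤ 2 ^ p * 2 ^ |η| * ‖e - z‖ ^ (p - ((d : ℝ) + σ)) := by
  have h0 : 0 < ‖z‖ := by linarith [hz.1]
  rcases eq_or_ne (e - z) 0 with h | h
  · rw [logWeight, h, norm_zero, Real.zero_rpow (by positivity), div_zero]
    positivity
  have hpos : 0 < ‖e - z‖ := norm_pos_iff.2 h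
  have h1 : min 1 |Real.log ‖z‖| ≤ 2 * ‖e - z‖ := by
    refine (min_le_right _ _).trans ((abs_log_le_two_mul_abs_sub_one hz.1).trans ?_)
    have := abs_norm_sub_norm_le z e
    rw [he, norm_sub_rev] at this
    linarith
  have h2 : ‖z‖ ^ η ≤ 2 ^ |η| := by
    rcases le_total 0 η with h | h
    · rw [abs_of_nonneg h]
      exact Real.rpow_le_rpow h0.le hz.2 h
    · rw [abs_of_nonpos h, Real.rpow_neg (by norm_num), ← Real.inv_rpow (by norm_num)]
      exact Real.rpow_le_rpow_of_nonpos (by norm_num) (by simpa using hz.1) h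
  rw [logWeight]
  calc min 1 |Real.log ‖z‖| ^ p * ‖z‖ ^ η / ‖e - z‖ ^ ((d : ℝ) + σ)
      ≤ (2 * ‖e - z‖) ^ p * 2 ^ |η| / ‖e - z‖ ^ ((d : ℝ) + σ) := by
        gcongr
    _ = _ := by
      rw [Real.mul_rpow (by norm_num) hpos.le, Real.rpow_sub hpos]
      ring

lemma setLIntegral_const_mul_ofReal_lt_top {C : ℝ} (hC : 0 ≤ C) {f g : 𝔼 → ℝ} {S : Set 𝔼}
    (hS : MeasurableSet S) (hfg : ∀ z ∈ S, f z ≤ C * g z)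
    (h : ∫⁻ z in S, ENNReal.ofReal (g z) < ∞) : ∫⁻ z in S, ENNReal.ofReal (f z) < ∞ := by
  calc ∫⁻ z in S, ENNReal.ofReal (f z)
      ≤ ∫⁻ z in S, ENNReal.ofReal C * ENNReal.ofReal (g z) := by
        refine setLIntegral_mono' hS fun z hz ↦ ?_
        rw [← ENNReal.ofReal_mul hC]
        exact ENNReal.ofReal_le_ofReal (hfg z hz)
    _ = ENNReal.ofReal C * ∫⁻ z in S, ENNReal.ofReal (g z) :=
        lintegral_const_mul' _ _ ENNReal.ofReal_ne_top
    _ < ∞ := ENNReal.mul_lt_top ENNReal.ofReal_lt_top h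

lemma lintegral_logWeight_lt_top (hd : 1 ≤ d) {σ p η : ℝ} (hσ : 0 < σ) (hσp : σ < p) {e : 𝔼}
    (he : ‖e‖ = 1) (h1 : -(d : ℝ) < η) (h2 : η < σ) :
    ∫⁻ z : 𝔼, ENNReal.ofReal (logWeight d σ p η e z) < ∞ := by
  have hp : 0 ≤ p := by linarith
  set A : Set 𝔼 := {z | ‖z‖ ∈ Iio (1 / 2)}
  set B : Set 𝔼 := {z | ‖z‖ ∈ Ioi 2}
  set D : Set 𝔼 := {z | ‖z‖ ∈ Icc (1 / 2) 2}
  have hA : MeasurableSet A := measurable_norm measurableSet_Iio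
  have hB : MeasurableSet B := measurable_norm measurableSet_Ioi
  have hD : MeasurableSet D := measurable_norm measurableSet_Icc
  have hu : univ = (A ∪ B) ∪ D := by
    ext z
    simp only [A, B, D, mem_univ, mem_union, mem_ofPred_eq, mem_Iio, mem_Ioi, mem_Icc, true_iff]
    grind
  rw [← setLIntegral_univ, hu]
  refine (lintegral_union_le _ _ _).trans_lt (ENNReal.add_lt_top.2 ⟨?_, ?_⟩)
  · refine (lintegral_union_le _ _ _).trans_lt (ENNReal.add_lt_top.2 ⟨?_, ?_⟩)
    · exact setLIntegral_const_mul_ofReal_lt_top (C := 2 ^ ((d : ℝ) + σ)) (by positivity) hA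
        (fun z hz ↦ logWeight_le_of_norm_lt hσ hp he hz)
        (setLIntegral_ball_rpow_norm_lt_top hd h1 _)
    · exact setLIntegral_const_mul_ofReal_lt_top (C := 2 ^ ((d : ℝ) + σ)) (by positivity) hB
        (fun z hz ↦ logWeight_le_of_lt_norm hσ hp he hz)
        (setLIntegral_compl_ball_rpow_norm_lt_top hd (by linarith) (by norm_num))
  · refine setLIntegral_const_mul_ofReal_lt_top (C := 2 ^ p * 2 ^ |η|) (by positivity) hD
        (fun z hz ↦ logWeight_le_of_norm_mem hσ hp he hz) ?_
    have h3 := setLIntegral_ball_rpow_norm_lt_top hd (η := p - ((d : ℝ) + σ)) (by linarith) 4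
    have hm : MeasurableSet {x : 𝔼 | ‖x‖ ∈ Iio 4} := measurable_norm measurableSet_Iio
    rw [← lintegral_indicator hm, ← lintegral_sub_left_eq_self _ e] at h3
    rw [← lintegral_indicator hD]
    refine (lintegral_mono fun z ↦ ?_).trans_lt h3
    by_cases hz : z ∈ D
    · have : e - z ∈ {x : 𝔼 | ‖x‖ ∈ Iio 4} := by
        have h4 : ‖z‖ ≤ 2 := hz.2
        have := norm_sub_le e z
        simp only [mem_ofPred_eq, mem_Iio]
        linarith
      rw [indicator_of_mem hz, indicator_of_mem this]
    · rw [indicator_of_notMem hz]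
      exact zero_le

end Finiteness

section Minkowski

variable {X Z : Type*} [MeasurableSpace X] [MeasurableSpace Z] {ν : Measure X} {μ : Measure Z}

/-- A form of Minkowski's integral inequality: a lower bound for the `L^q` norms in the first
variable passes to the mixed norm. -/
lemma rpow_mul_le_lintegral_rpow_lintegral [SFinite ν] [SFinite μ] {p q : ℝ} (hq : 0 < q)
    (hqp : q ≤ p)
    {F : X → Z → ℝ≥0∞} (hF : Measurable (Function.uncurry F)) {m : Z → ℝ≥0∞} (hm : Measurable m)
    {W : ℝ≥0∞} (hW : ∀ᵐ z ∂μ, m z ^ q * W ≤ ∫⁻ x, F x z ^ q ∂ν) (hI : ∫⁻ z, m z ^ p ∂μ ≠ ∞) :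
    (∫⁻ z, m z ^ p ∂μ) ^ (q / p) * W ≤ ∫⁻ x, (∫⁻ z, F x z ^ p ∂μ) ^ (q / p) ∂ν := by
  have hp : 0 < p := hq.trans_le hqp
  set I := ∫⁻ z, m z ^ p ∂μ with hIdef
  have hFx : ∀ x, Measurable (F x) := fun x ↦ hF.comp measurable_prodMk_left
  have hswap : I * W ≤ ∫⁻ x, ∫⁻ z, F x z ^ q * m z ^ (p - q) ∂μ ∂ν := by
    have hmeas : Measurable (Function.uncurry fun x z ↦ F x z ^ q * m z ^ (p - q)) :=
      (hF.pow_const q).mul ((hm.comp measurable_snd).pow_const _)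
    rw [lintegral_lintegral_swap hmeas.aemeasurable, hIdef, ← lintegral_mul_const _ (hm.pow_const p)]
    refine lintegral_mono_ae ?_
    filter_upwards [hW] with z hz
    have hFz : Measurable fun x ↦ F x z := hF.comp measurable_prodMk_right
    rw [lintegral_mul_const _ (hFz.pow_const q)]
    have : m z ^ p = m z ^ q * m z ^ (p - q) := by
      rw [← ENNReal.rpow_add_of_nonneg _ _ hq.le (by linarith)]
      congr 1
      ring
    rw [this, mul_right_comm]
    gcongr
  rcases eq_or_ne I 0 with hI0 | hI0
  · rw [hI0, ENNReal.zero_rpow_of_pos (by positivity), zero_mul]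
    exact zero_le
  have hholder : ∀ x, ∫⁻ z, F x z ^ q * m z ^ (p - q) ∂μ ≤
      (∫⁻ z, F x z ^ p ∂μ) ^ (q / p) * I ^ (1 - q / p) := by
    intro x
    rcases hqp.eq_or_lt with h | h
    · simp [h, hp.ne']
    have hc : (p / q).HolderConjugate (p / (p - q)) := by
      rw [Real.holderConjugate_iff]
      refine ⟨(one_lt_div hq).2 h, ?_⟩
      field_simp
      ring
    have h1 := ENNReal.lintegral_mul_le_Lp_mul_Lq μ hc ((hFx x).pow_const q).aemeasurable
      (hm.pow_const (p - q)).aemeasurable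
    have h2 : p - q ≠ 0 := by linarith
    simp only [Pi.mul_apply, ← ENNReal.rpow_mul] at h1
    rw [mul_div_cancel₀ _ hq.ne', mul_div_cancel₀ _ h2] at h1
    have h3 : 1 / (p / q) = q / p := by field_simp
    have h4 : 1 / (p / (p - q)) = 1 - q / p := by field_simp
    rwa [h3, h4] at h1
  have h5 : I = I ^ (q / p) * I ^ (1 - q / p) := by
    rw [← ENNReal.rpow_add _ _ hI0 hI]
    simp
  have h6 : I ^ (1 - q / p) ≠ 0 := by simp [ENNReal.rpow_eq_zero_iff, hI0, hI]
  have h7 : I ^ (1 - q / p) ≠ ∞ := by simp [ENNReal.rpow_eq_top_iff, hI0, hI]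
  have h8 : I ^ (1 - q / p) * (I ^ (q / p) * W) ≤
      I ^ (1 - q / p) * ∫⁻ x, (∫⁻ z, F x z ^ p ∂μ) ^ (q / p) ∂ν := by
    calc I ^ (1 - q / p) * (I ^ (q / p) * W) = I * W := by
          conv_rhs => rw [h5]
          ring
      _ ≤ ∫⁻ x, ∫⁻ z, F x z ^ q * m z ^ (p - q) ∂μ ∂ν := hswap
      _ ≤ ∫⁻ x, (∫⁻ z, F x z ^ p ∂μ) ^ (q / p) * I ^ (1 - q / p) ∂ν :=
          lintegral_mono hholder
      _ = _ := by rw [lintegral_mul_const' _ _ h7, mul_comm]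
  exact (ENNReal.mul_le_mul_iff_right h6 h7).1 h8

/-- The reverse triangle inequality in `L^q`, for two functions whose norms differ by a factor. -/
lemma abs_one_sub_rpow_mul_le_lintegral {q : ℝ} (hq : 1 ≤ q) {f g : X → ℝ} (hf : Measurable f)
    (hg : Measurable g) {c : ℝ} (hc : 0 ≤ c) {W : ℝ≥0∞} (hW : W ≠ ∞)
    (h1 : ∫⁻ x, ENNReal.ofReal |f x| ^ q ∂ν = W)
    (h2 : ∫⁻ x, ENNReal.ofReal |g x| ^ q ∂ν = ENNReal.ofReal c ^ q * W) :
    ENNReal.ofReal |1 - c| ^ q * W ≤ ∫⁻ x, ENNReal.ofReal |f x - g x| ^ q ∂ν := by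
  have hq0 : 0 < q := by linarith
  set D := ∫⁻ x, ENNReal.ofReal |f x - g x| ^ q ∂ν with hD
  have mf : Measurable fun x ↦ ENNReal.ofReal |f x| := by fun_prop
  have mg : Measurable fun x ↦ ENNReal.ofReal |g x| := by fun_prop
  have md : Measurable fun x ↦ ENNReal.ofReal |f x - g x| := by fun_prop
  have key1 : W ^ (1 / q) ≤ D ^ (1 / q) + ENNReal.ofReal c * W ^ (1 / q) := by
    have h := ENNReal.lintegral_Lp_add_le (μ := ν) md.aemeasurable mg.aemeasurable hq
    rw [h2, ENNReal.mul_rpow_of_nonneg _ _ (by positivity), ← ENNReal.rpow_mul,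
      mul_one_div_cancel hq0.ne', ENNReal.rpow_one] at h
    refine le_trans ?_ h
    rw [← h1]
    gcongr with x
    rw [Pi.add_apply, ← ENNReal.ofReal_add (abs_nonneg _) (abs_nonneg _)]
    refine ENNReal.ofReal_le_ofReal ?_
    simpa using abs_add_le (f x - g x) (g x)
  have key2 : ENNReal.ofReal c * W ^ (1 / q) ≤ D ^ (1 / q) + W ^ (1 / q) := by
    have h := ENNReal.lintegral_Lp_add_le (μ := ν) md.aemeasurable mf.aemeasurable hq
    rw [h1] at h
    have h3 : ENNReal.ofReal c * W ^ (1 / q) =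
        (∫⁻ x, ENNReal.ofReal |g x| ^ q ∂ν) ^ (1 / q) := by
      rw [h2, ENNReal.mul_rpow_of_nonneg _ _ (by positivity), ← ENNReal.rpow_mul,
        mul_one_div_cancel hq0.ne', ENNReal.rpow_one]
    rw [h3]
    refine le_trans ?_ h
    gcongr with x
    rw [Pi.add_apply, ← ENNReal.ofReal_add (abs_nonneg _) (abs_nonneg _)]
    refine ENNReal.ofReal_le_ofReal ?_
    have := abs_sub_abs_le_abs_sub (g x) (f x)
    rw [abs_sub_comm] at this
    linarith
  have key : ENNReal.ofReal |1 - c| * W ^ (1 / q) ≤ D ^ (1 / q) := by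
    have hV : W ^ (1 / q) ≠ ∞ := ENNReal.rpow_ne_top_of_nonneg (by positivity) hW
    rcases eq_or_ne (D ^ (1 / q)) ∞ with hDt | hDt
    · rw [hDt]
      exact le_top
    lift W ^ (1 / q) to NNReal using hV with w
    lift D ^ (1 / q) to NNReal using hDt with δ
    have e1 : (w : ℝ) ≤ δ + c * w := by
      have := ENNReal.toReal_mono (by finiteness) key1
      rwa [ENNReal.toReal_add (by finiteness) (by finiteness), ENNReal.toReal_mul,
        ENNReal.toReal_ofReal hc] at this
    have e2 : c * (w : ℝ) ≤ δ + w := by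
      have := ENNReal.toReal_mono (by finiteness) key2
      rwa [ENNReal.toReal_add (by finiteness) (by finiteness), ENNReal.toReal_mul,
        ENNReal.toReal_ofReal hc] at this
    rw [← ENNReal.ofReal_coe_nnreal, ← ENNReal.ofReal_coe_nnreal,
      ← ENNReal.ofReal_mul (abs_nonneg _)]
    refine ENNReal.ofReal_le_ofReal ?_
    rcases abs_cases (1 - c) with ⟨h, _⟩ | ⟨h, _⟩ <;> rw [h] <;> linarith
  have h9 := ENNReal.rpow_le_rpow key hq0.le
  rwa [ENNReal.mul_rpow_of_nonneg _ _ hq0.le, ← ENNReal.rpow_mul, ← ENNReal.rpow_mul,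
    one_div_mul_cancel hq0.ne', ENNReal.rpow_one, ENNReal.rpow_one] at h9

end Minkowski

section Inequality

variable {d : ℕ}

local notation "𝔼" => EuclideanSpace ℝ (Fin d)

/-- The kernel `‖z‖^β / ‖e - z‖^(d+σ)` seen from a unit vector `e`. -/
noncomputable def unitKernel (d : ℕ) (σ β : ℝ) (e z : EuclideanSpace ℝ (Fin d)) : ℝ≥0∞ :=
  ENNReal.ofReal (‖z‖ ^ β / ‖e - z‖ ^ ((d : ℝ) + σ))

lemma measurable_unitKernel {σ β : ℝ} {e : 𝔼} : Measurable (unitKernel d σ β e) := by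
  unfold unitKernel
  fun_prop

/-- The inner integral of the Triebel–Lizorkin seminorm in coordinates adapted to the point. -/
lemma lintegral_difference_eq {p σ β : ℝ} (hp : 0 ≤ p) {e : 𝔼} {r : ℝ} (hr : 0 < r)
    (g : OrthGroup d) (u : 𝔼 → ℝ) :
    ∫⁻ y, ENNReal.ofReal (|u (r • g.act e) - u y| ^ p / ‖r • g.act e - y‖ ^ ((d : ℝ) + σ) *
        ‖y‖ ^ β) =
      ENNReal.ofReal (r ^ (β - σ)) *
        ∫⁻ z, ENNReal.ofReal |u (r • g.act e) - u (r • g.act z)| ^ p * unitKernel d σ β e z := by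
  set f : 𝔼 → ℝ≥0∞ := fun y ↦ ENNReal.ofReal (|u (r • g.act e) - u y| ^ p /
    ‖r • g.act e - y‖ ^ ((d : ℝ) + σ) * ‖y‖ ^ β) with hf
  have h1 : ∫⁻ y, f y = ENNReal.ofReal (r ^ (d : ℝ)) * ∫⁻ z, f (r • g.act z) := by
    have h2 := lintegral_comp_smul_of_pos (volume : Measure 𝔼) hr f
    rw [finrank_euclideanSpace_fin] at h2
    have h3 : ∫⁻ z, f (r • g.act z) = ∫⁻ z, f (r • z) := g.lintegral_act fun z ↦ f (r • z)
    rw [h3, h2, ← mul_assoc, ← ENNReal.ofReal_mul (by positivity), ← Real.rpow_add hr]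
    simp
  rw [h1, ← lintegral_const_mul' _ _ ENNReal.ofReal_ne_top,
    ← lintegral_const_mul' _ _ ENNReal.ofReal_ne_top]
  refine lintegral_congr fun z ↦ ?_
  have h4 : ‖r • g.act e - r • g.act z‖ = r * ‖e - z‖ := by
    rw [← smul_sub, ← g.act_sub, norm_smul, g.norm_act, Real.norm_of_nonneg hr.le]
  have h5 : ‖r • g.act z‖ = r * ‖z‖ := by
    rw [norm_smul, g.norm_act, Real.norm_of_nonneg hr.le]
  simp only [hf, unitKernel]
  rw [ENNReal.ofReal_rpow_of_nonneg (abs_nonneg _) hp, ← ENNReal.ofReal_mul (by positivity),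
    ← ENNReal.ofReal_mul (by positivity), ← ENNReal.ofReal_mul (by positivity), h4, h5,
    Real.mul_rpow hr.le (norm_nonneg _), Real.mul_rpow hr.le (norm_nonneg _)]
  congr 1
  have h6 : r ^ (β - σ) = r ^ (d : ℝ) * r ^ β / r ^ ((d : ℝ) + σ) := by
    rw [← Real.rpow_add hr, ← Real.rpow_sub hr]
    congr 1
    ring
  rw [h6, div_eq_mul_inv, mul_inv, div_eq_mul_inv, div_eq_mul_inv]
  ring

/-- The integrand of the Triebel–Lizorkin seminorm. -/
noncomputable def seminormDensity (d : ℕ) (s p q α β : ℝ) (u : EuclideanSpace ℝ (Fin d) → ℝ)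
    (x : EuclideanSpace ℝ (Fin d)) : ℝ≥0∞ :=
  (∫⁻ y : EuclideanSpace ℝ (Fin d),
      ENNReal.ofReal (|u x - u y| ^ p / ‖x - y‖ ^ ((d : ℝ) + s * p) * ‖y‖ ^ β)) ^ (q / p) *
    ENNReal.ofReal (‖x‖ ^ α)

lemma measurable_seminormDensity {s p q α β : ℝ} {u : 𝔼 → ℝ} (hu : Measurable u) :
    Measurable (seminormDensity d s p q α β u) := by
  unfold seminormDensity
  refine Measurable.mul (Measurable.pow_const (Measurable.lintegral_prod_right'
    (f := fun z : 𝔼 × 𝔼 ↦ ENNReal.ofReal (|u z.1 - u z.2| ^ p /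
      ‖z.1 - z.2‖ ^ ((d : ℝ) + s * p) * ‖z.2‖ ^ β)) ?_) _) ?_ <;> fun_prop

lemma seminormDensity_eq {s p q α β : ℝ} (hp : 0 < p) (hq : 0 ≤ q) {e : 𝔼} (he : ‖e‖ = 1) {r : ℝ}
    (hr : 0 < r) (g : OrthGroup d) (u : 𝔼 → ℝ) :
    seminormDensity d s p q α β u (r • g.act e) =
      ENNReal.ofReal (r ^ (-(s * q - α - q * β / p))) *
        (∫⁻ z, ENNReal.ofReal |u (r • g.act e) - u (r • g.act z)| ^ p *
          unitKernel d (s * p) β e z) ^ (q / p) := by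
  have h1 : ‖r • g.act e‖ = r := by
    rw [norm_smul, g.norm_act, Real.norm_of_nonneg hr.le, he, mul_one]
  rw [seminormDensity, lintegral_difference_eq hp.le hr g u, h1,
    ENNReal.mul_rpow_of_nonneg _ _ (by positivity),
    ENNReal.ofReal_rpow_of_nonneg (by positivity) (by positivity), ← Real.rpow_mul hr.le,
    mul_right_comm, ← ENNReal.ofReal_mul (by positivity), ← Real.rpow_add hr]
  congr 3
  field_simp
  ring

/-- The constant of the Hardy inequality as an integral over `ℝ^d`. -/
noncomputable def groundIntegral (d : ℕ) (σ p a β : ℝ) (e : EuclideanSpace ℝ (Fin d)) : ℝ≥0∞ :=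
  ∫⁻ z, ENNReal.ofReal |1 - ‖z‖ ^ (-a)| ^ p * unitKernel d σ β e z

/-- The weighted `L^q` norm of `u` along the orbit of a vector `v`. -/
lemma lintegral_orbit_eq {γ q : ℝ} (hq : 0 ≤ q) {u : 𝔼 → ℝ} (hu : Measurable u) {v : 𝔼}
    (hv : v ≠ 0) :
    ∫⁻ x : 𝔼, ∫⁻ g : OrthGroup d, ENNReal.ofReal (‖x‖ ^ (-γ)) *
        ENNReal.ofReal |u (‖x‖ • g.act v)| ^ q ∂OrthGroup.haar d =
      ENNReal.ofReal (‖v‖ ^ (γ - d)) * ∫⁻ x, ENNReal.ofReal (|u x| ^ q / ‖x‖ ^ γ) := by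
  have hv' : 0 < ‖v‖ := norm_pos_iff.2 hv
  have mA : Measurable fun x ↦ ENNReal.ofReal (|u x| ^ q / ‖x‖ ^ γ) := by fun_prop
  have h1 : ∀ (x : 𝔼) (g : OrthGroup d), ENNReal.ofReal (‖x‖ ^ (-γ)) *
      ENNReal.ofReal |u (‖x‖ • g.act v)| ^ q = ENNReal.ofReal (‖v‖ ^ γ) *
        ENNReal.ofReal (|u (‖x‖ • g.act v)| ^ q / ‖‖x‖ • g.act v‖ ^ γ) := by
    intro x g
    rw [norm_smul, g.norm_act, norm_norm, Real.mul_rpow (norm_nonneg _) (norm_nonneg _),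
      ENNReal.ofReal_rpow_of_nonneg (abs_nonneg _) hq, ← ENNReal.ofReal_mul (by positivity),
      ← ENNReal.ofReal_mul (by positivity), Real.rpow_neg (norm_nonneg _)]
    congr 1
    have : ‖v‖ ^ γ ≠ 0 := (Real.rpow_pos_of_pos hv' γ).ne'
    field_simp
  simp_rw [h1]
  simp_rw [lintegral_const_mul' _ _ ENNReal.ofReal_ne_top]
  rw [OrthGroup.lintegral_average_of_ne_zero hv mA,
    ← mul_assoc, ← ENNReal.ofReal_mul (by positivity), ← Real.rpow_add hv', sub_eq_add_neg]

/-- The Triebel–Lizorkin seminorm as an integral over points and rotations. -/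
lemma triebelLizorkin_eq_lintegral_orbit (hd : 1 ≤ d) {s p q α β : ℝ} (hp : 0 < p) (hq : 0 ≤ q)
    {e : 𝔼} (he : ‖e‖ = 1) {u : 𝔼 → ℝ} (hu : Measurable u) :
    triebelLizorkin d s p q α β u =
      ∫⁻ x : 𝔼, ∫⁻ g : OrthGroup d, ENNReal.ofReal (‖x‖ ^ (-(s * q - α - q * β / p))) *
        (∫⁻ z, ENNReal.ofReal |u (‖x‖ • g.act e) - u (‖x‖ • g.act z)| ^ p *
          unitKernel d (s * p) β e z) ^ (q / p) ∂OrthGroup.haar d := by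
  have := nontrivial_euclideanSpace hd
  have h3 : triebelLizorkin d s p q α β u = ∫⁻ x, seminormDensity d s p q α β u x := rfl
  rw [h3, ← OrthGroup.lintegral_average he (measurable_seminormDensity hu)]
  refine lintegral_congr_ae ?_
  filter_upwards [Measure.ae_ne volume (0 : 𝔼)] with x hx
  refine lintegral_congr fun g ↦ ?_
  rw [seminormDensity_eq hp hq he (norm_pos_iff.2 hx)]

lemma measurable_orbit {u : 𝔼 → ℝ} (hu : Measurable u) :
    Measurable fun w : (𝔼 × OrthGroup d) × 𝔼 ↦ u (‖w.1.1‖ • w.1.2.act w.2) :=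
  hu.comp ((measurable_norm.comp (measurable_fst.comp measurable_fst)).smul
    (OrthGroup.measurable_act.comp (measurable_snd.prodMk (measurable_snd.comp measurable_fst))))

lemma measurable_orbit_const {u : 𝔼 → ℝ} (hu : Measurable u) (v : 𝔼) :
    Measurable fun w : 𝔼 × OrthGroup d ↦ u (‖w.1‖ • w.2.act v) :=
  hu.comp ((measurable_norm.comp measurable_fst).smul
    (OrthGroup.measurable_act.comp (measurable_const.prodMk measurable_snd)))

lemma measurable_orbit_sub {u : 𝔼 → ℝ} (hu : Measurable u) (e : 𝔼) :
    Measurable fun w : (𝔼 × OrthGroup d) × 𝔼 ↦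
      ENNReal.ofReal |u (‖w.1.1‖ • w.1.2.act e) - u (‖w.1.1‖ • w.1.2.act w.2)| :=
  (((measurable_orbit_const hu e).comp measurable_fst).sub
    (measurable_orbit hu)).norm.ennreal_ofReal

lemma lintegral_withDensity_prod_haar {ρ : 𝔼 → ℝ} (hρ : Measurable ρ)
    {f : 𝔼 × OrthGroup d → ℝ≥0∞} (hf : Measurable f) :
    ∫⁻ w, f w ∂((volume : Measure 𝔼).withDensity fun x ↦ ENNReal.ofReal (ρ x)).prod
        (OrthGroup.haar d) =
      ∫⁻ x : 𝔼, ∫⁻ g : OrthGroup d, ENNReal.ofReal (ρ x) * f (x, g) ∂OrthGroup.haar d := by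
  rw [lintegral_prod _ hf.aemeasurable,
    lintegral_withDensity_eq_lintegral_mul _ hρ.ennreal_ofReal hf.lintegral_prod_right']
  refine lintegral_congr fun x ↦ ?_
  rw [Pi.mul_apply, lintegral_const_mul' _ _ ENNReal.ofReal_ne_top]

theorem groundIntegral_rpow_mul_hardyIntegral_le (hd : 1 ≤ d) {s p q α β : ℝ} (hq : 1 ≤ q)
    (hqp : q ≤ p) {e : 𝔼} (he : ‖e‖ = 1) {u : 𝔼 → ℝ} (hu : Measurable u)
    (hW : hardyIntegral d s p q α β u ≠ ∞)
    (hI : groundIntegral d (s * p) p (((d : ℝ) + α + q * β / p - s * q) / q) β e ≠ ∞) :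
    groundIntegral d (s * p) p (((d : ℝ) + α + q * β / p - s * q) / q) β e ^ (q / p) *
      hardyIntegral d s p q α β u ≤ triebelLizorkin d s p q α β u := by
  have hq0 : 0 < q := by linarith
  have hp0 : 0 < p := by linarith
  have := nontrivial_euclideanSpace hd
  generalize ha : ((d : ℝ) + α + q * β / p - s * q) / q = a at hI ⊢
  have haγ : -a * q = s * q - α - q * β / p - d := by
    rw [← ha]
    field_simp
    ring
  have mactv := measurable_orbit_const hu
  have mF := measurable_orbit_sub hu e
  have lκ : ∀ f : 𝔼 → ℝ≥0∞, Measurable f →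
      ∫⁻ z, f z ∂((volume : Measure 𝔼).withDensity (unitKernel d (s * p) β e)) =
        ∫⁻ z, f z * unitKernel d (s * p) β e z := fun f hf ↦ by
    rw [lintegral_withDensity_eq_lintegral_mul _ measurable_unitKernel hf]
    exact lintegral_congr fun z ↦ mul_comm _ _
  have hIκ : groundIntegral d (s * p) p a β e = ∫⁻ z, ENNReal.ofReal |1 - ‖z‖ ^ (-a)| ^ p
      ∂((volume : Measure 𝔼).withDensity (unitKernel d (s * p) β e)) := by
    rw [lκ _ (by fun_prop), groundIntegral]
  have mρ : Measurable fun x : 𝔼 ↦ ‖x‖ ^ (-(s * q - α - q * β / p)) := by fun_prop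
  have hnorm : ∀ v : 𝔼, v ≠ 0 → ∫⁻ w, ENNReal.ofReal |u (‖w.1‖ • w.2.act v)| ^ q
      ∂((volume : Measure 𝔼).withDensity fun x ↦
        ENNReal.ofReal (‖x‖ ^ (-(s * q - α - q * β / p)))).prod (OrthGroup.haar d) =
      ENNReal.ofReal (‖v‖ ^ (-a)) ^ q * hardyIntegral d s p q α β u := by
    intro v hv
    have mv : Measurable fun w : 𝔼 × OrthGroup d ↦ ENNReal.ofReal |u (‖w.1‖ • w.2.act v)| ^ q :=
      (mactv v).norm.ennreal_ofReal.pow_const q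
    rw [lintegral_withDensity_prod_haar mρ mv, lintegral_orbit_eq hq0.le hu hv,
      ENNReal.ofReal_rpow_of_nonneg (by positivity) hq0.le, ← Real.rpow_mul (norm_nonneg _), haγ]
    rfl
  have hTL : triebelLizorkin d s p q α β u = ∫⁻ w,
      (∫⁻ z, ENNReal.ofReal |u (‖w.1‖ • w.2.act e) - u (‖w.1‖ • w.2.act z)| ^ p
        ∂((volume : Measure 𝔼).withDensity (unitKernel d (s * p) β e))) ^ (q / p)
      ∂((volume : Measure 𝔼).withDensity fun x ↦
        ENNReal.ofReal (‖x‖ ^ (-(s * q - α - q * β / p)))).prod (OrthGroup.haar d) := by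
    have mFp := mF.pow_const p
    rw [lintegral_withDensity_prod_haar mρ (mFp.lintegral_prod_right'.pow_const _),
      triebelLizorkin_eq_lintegral_orbit hd hp0 hq0.le he hu]
    refine lintegral_congr fun x ↦ lintegral_congr fun g ↦ ?_
    have mg : Measurable fun z ↦ u (‖x‖ • g.act z) :=
      hu.comp ((OrthGroup.measurePreserving_act g).measurable.const_smul ‖x‖)
    have mz : Measurable fun z ↦ ENNReal.ofReal |u (‖x‖ • g.act e) - u (‖x‖ • g.act z)| ^ p :=
      (measurable_const.sub mg).norm.ennreal_ofReal.pow_const p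
    rw [lκ _ mz]
  rw [hTL, hIκ]
  have : SigmaFinite ((volume : Measure 𝔼).withDensity fun x ↦
      ENNReal.ofReal (‖x‖ ^ (-(s * q - α - q * β / p)))) :=
    SigmaFinite.withDensity_ofReal _
  have : SigmaFinite ((volume : Measure 𝔼).withDensity (unitKernel d (s * p) β e)) :=
    SigmaFinite.withDensity_ofReal _
  have hae : ∀ᵐ z ∂((volume : Measure 𝔼).withDensity (unitKernel d (s * p) β e)), z ≠ 0 :=
    (withDensity_absolutelyContinuous _ _).ae_le (Measure.ae_ne volume (0 : 𝔼))
  have hlow : ∀ᵐ z ∂((volume : Measure 𝔼).withDensity (unitKernel d (s * p) β e)),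
      ENNReal.ofReal |1 - ‖z‖ ^ (-a)| ^ q * hardyIntegral d s p q α β u ≤
        ∫⁻ w, ENNReal.ofReal |u (‖w.1‖ • w.2.act e) - u (‖w.1‖ • w.2.act z)| ^ q
          ∂((volume : Measure 𝔼).withDensity fun x ↦
            ENNReal.ofReal (‖x‖ ^ (-(s * q - α - q * β / p)))).prod (OrthGroup.haar d) := by
    filter_upwards [hae] with z hz
    refine abs_one_sub_rpow_mul_le_lintegral hq (mactv e) (mactv z) (by positivity) hW ?_ ?_
    · rw [hnorm e (norm_ne_zero_iff.1 (he ▸ one_ne_zero)), he]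
      simp
    · exact hnorm z hz
  have mm : Measurable fun z : 𝔼 ↦ ENNReal.ofReal |1 - ‖z‖ ^ (-a)| := by fun_prop
  rw [hIκ] at hI
  exact rpow_mul_le_lintegral_rpow_lintegral (X := 𝔼 × OrthGroup d) (Z := 𝔼)
    (F := fun w z ↦ ENNReal.ofReal |u (‖w.1‖ • w.2.act e) - u (‖w.1‖ • w.2.act z)|)
    hq0 hqp mF mm hlow hI

end Inequality

section Domination

variable {d : ℕ}

local notation "𝔼" => EuclideanSpace ℝ (Fin d)

lemma abs_one_sub_exp_le (y : ℝ) : |1 - Real.exp y| ≤ |y| * (1 + Real.exp y) := by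
  have h1 := Real.add_one_le_exp y
  have h2 := Real.add_one_le_exp (-y)
  have h3 := Real.exp_pos y
  have h4 : Real.exp (-y) * Real.exp y = 1 := by rw [← Real.exp_add]; simp
  rcases le_total 0 y with h | h
  · rw [abs_of_nonpos (by linarith), abs_of_nonneg h]
    nlinarith [mul_le_mul_of_nonneg_right h2 h3.le]
  · have : Real.exp y ≤ 1 := Real.exp_le_one_iff.2 h
    rw [abs_of_nonneg (by linarith), abs_of_nonpos h]
    nlinarith

lemma abs_one_sub_rpow_le {t : ℝ} (ht : 0 < t) (a : ℝ) :
    |1 - t ^ (-a)| ≤ (1 + |a|) * (min 1 |Real.log t| * (1 + t ^ (-a))) := by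
  have h0 : 0 < t ^ (-a) := Real.rpow_pos_of_pos ht _
  have h1 : |1 - t ^ (-a)| ≤ |a| * |Real.log t| * (1 + t ^ (-a)) := by
    have := abs_one_sub_exp_le (Real.log t * (-a))
    rwa [← Real.rpow_def_of_pos ht, abs_mul, abs_neg, mul_comm |Real.log t|] at this
  have h2 : |1 - t ^ (-a)| ≤ 1 + t ^ (-a) := by
    rw [abs_le]
    constructor <;> linarith
  have h3 := abs_nonneg a
  rcases min_cases 1 |Real.log t| with ⟨h, _⟩ | ⟨h, _⟩ <;> rw [h]
  · nlinarith
  · have : 0 ≤ |Real.log t| * (1 + t ^ (-a)) := by positivity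
    nlinarith

/-- The radial function dominating all difference quotients of the test functions. -/
noncomputable def dominator (a δ t : ℝ) : ℝ :=
  min 1 |Real.log t| * (1 + t ^ (-a)) * (t ^ δ + t ^ (-δ))

lemma dominator_nonneg {a δ t : ℝ} (ht : 0 ≤ t) : 0 ≤ dominator a δ t := by
  unfold dominator
  positivity

lemma one_le_rpow_add_rpow_neg {t : ℝ} (ht : 0 < t) (δ : ℝ) : 1 ≤ t ^ δ + t ^ (-δ) := by
  have h1 : 0 < t ^ δ := Real.rpow_pos_of_pos ht _
  rw [Real.rpow_neg ht.le]
  rcases le_total 1 (t ^ δ) with h | h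
  · have : 0 < (t ^ δ)⁻¹ := by positivity
    linarith
  · have := (one_le_inv₀ h1).2 h
    linarith

lemma abs_one_sub_rpow_le_dominator {t : ℝ} (ht : 0 < t) (a δ : ℝ) :
    |1 - t ^ (-a)| ≤ (1 + |a|) * dominator a δ t := by
  refine (abs_one_sub_rpow_le ht a).trans ?_
  rw [dominator]
  exact mul_le_mul_of_nonneg_left
    (le_mul_of_one_le_right (by positivity) (one_le_rpow_add_rpow_neg ht δ)) (by positivity)

lemma add_rpow_le_two_rpow_mul {x y p : ℝ} (hx : 0 ≤ x) (hy : 0 ≤ y) (hp : 0 ≤ p) :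
    (x + y) ^ p ≤ 2 ^ p * (x ^ p + y ^ p) := by
  have key : ∀ {x y : ℝ}, 0 ≤ x → 0 ≤ y → x ≤ y → (x + y) ^ p ≤ 2 ^ p * (x ^ p + y ^ p) := by
    intro x y hx hy h
    calc (x + y) ^ p ≤ (2 * y) ^ p := Real.rpow_le_rpow (by positivity) (by linarith) hp
      _ = 2 ^ p * y ^ p := Real.mul_rpow (by norm_num) hy
      _ ≤ _ := by
        gcongr
        have := Real.rpow_nonneg hx p
        linarith
  rcases le_total x y with h | h
  · exact key hx hy h
  · rw [add_comm x, add_comm (x ^ p)]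
    exact key hy hx h

lemma dominator_rpow_mul_kernel_le {σ p a β δ : ℝ} (hp : 0 < p) (e z : 𝔼) :
    dominator a δ ‖z‖ ^ p * (‖z‖ ^ β / ‖e - z‖ ^ ((d : ℝ) + σ)) ≤
      2 ^ p * 2 ^ p * (logWeight d σ p (β + p * δ) e z + logWeight d σ p (β - p * δ) e z +
        (logWeight d σ p (β - p * a + p * δ) e z + logWeight d σ p (β - p * a - p * δ) e z)) := by
  rcases eq_or_ne z 0 with rfl | hz
  · have : dominator a δ ‖(0 : 𝔼)‖ = 0 := by simp [dominator]
    rw [this, Real.zero_rpow hp.ne', zero_mul]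
    unfold logWeight
    positivity
  have ht : 0 < ‖z‖ := norm_pos_iff.2 hz
  have hN : 0 ≤ ‖e - z‖ ^ ((d : ℝ) + σ) := by positivity
  simp only [logWeight, dominator]
  generalize ‖z‖ = t at ht
  generalize ‖e - z‖ ^ ((d : ℝ) + σ) = N at hN
  have h1 : (1 + t ^ (-a)) ^ p ≤ 2 ^ p * (1 + t ^ (-(p * a))) := by
    have := add_rpow_le_two_rpow_mul zero_le_one (Real.rpow_pos_of_pos ht (-a)).le hp.le
    rwa [Real.one_rpow, ← Real.rpow_mul ht.le, neg_mul, mul_comm a] at this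
  have h2 : (t ^ δ + t ^ (-δ)) ^ p ≤ 2 ^ p * (t ^ (p * δ) + t ^ (-(p * δ))) := by
    have := add_rpow_le_two_rpow_mul (Real.rpow_pos_of_pos ht δ).le
      (Real.rpow_pos_of_pos ht (-δ)).le hp.le
    rwa [← Real.rpow_mul ht.le, ← Real.rpow_mul ht.le, neg_mul, mul_comm δ] at this
  have hpos : 0 ≤ t ^ (-a) := by positivity
  calc (min 1 |Real.log t| * (1 + t ^ (-a)) * (t ^ δ + t ^ (-δ))) ^ p * (t ^ β / N)
      = min 1 |Real.log t| ^ p * (1 + t ^ (-a)) ^ p * (t ^ δ + t ^ (-δ)) ^ p * (t ^ β / N) := by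
        rw [Real.mul_rpow (by positivity) (by positivity),
          Real.mul_rpow (by positivity) (by positivity)]
    _ ≤ min 1 |Real.log t| ^ p * (2 ^ p * (1 + t ^ (-(p * a)))) *
          (2 ^ p * (t ^ (p * δ) + t ^ (-(p * δ)))) * (t ^ β / N) := by gcongr
    _ = _ := by
      simp only [sub_eq_add_neg, Real.rpow_add ht]
      ring

lemma lintegral_dominator_lt_top (hd : 1 ≤ d) {σ p a β δ : ℝ} (hσ : 0 < σ) (hσp : σ < p)
    {e : 𝔼} (he : ‖e‖ = 1) (hδ : 0 ≤ δ) (h1 : -(d : ℝ) < β - p * δ) (h2 : β + p * δ < σ)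
    (h3 : -(d : ℝ) < β - p * a - p * δ) (h4 : β - p * a + p * δ < σ) :
    ∫⁻ z : 𝔼, ENNReal.ofReal (dominator a δ ‖z‖) ^ p * unitKernel d σ β e z < ∞ := by
  have hp : 0 < p := hσ.trans hσp
  have hpδ : 0 ≤ p * δ := by positivity
  have h5 : ∀ z : 𝔼, ENNReal.ofReal (dominator a δ ‖z‖) ^ p * unitKernel d σ β e z ≤
      ENNReal.ofReal (2 ^ p * 2 ^ p) * (ENNReal.ofReal (logWeight d σ p (β + p * δ) e z) +
        ENNReal.ofReal (logWeight d σ p (β - p * δ) e z) +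
        (ENNReal.ofReal (logWeight d σ p (β - p * a + p * δ) e z) +
          ENNReal.ofReal (logWeight d σ p (β - p * a - p * δ) e z))) := by
    intro z
    rw [unitKernel, ENNReal.ofReal_rpow_of_nonneg (dominator_nonneg (norm_nonneg _)) hp.le,
      ← ENNReal.ofReal_mul (Real.rpow_nonneg (dominator_nonneg (norm_nonneg _)) _),
      ← ENNReal.ofReal_add, ← ENNReal.ofReal_add, ← ENNReal.ofReal_add, ← ENNReal.ofReal_mul]
    · exact ENNReal.ofReal_le_ofReal (dominator_rpow_mul_kernel_le hp e z)
    all_goals (try unfold logWeight); positivity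
  have mw : ∀ η, Measurable fun z : 𝔼 ↦ ENNReal.ofReal (logWeight d σ p η e z) := by
    intro η
    unfold logWeight
    fun_prop
  refine (lintegral_mono h5).trans_lt ?_
  rw [lintegral_const_mul' _ _ ENNReal.ofReal_ne_top, lintegral_add_left ((mw (β + p * δ)).fun_add (mw (β - p * δ))),
    lintegral_add_left (mw _), lintegral_add_left (mw _)]
  refine ENNReal.mul_lt_top ENNReal.ofReal_lt_top (ENNReal.add_lt_top.2
    ⟨ENNReal.add_lt_top.2 ⟨?_, ?_⟩, ENNReal.add_lt_top.2 ⟨?_, ?_⟩⟩) <;>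
  exact lintegral_logWeight_lt_top hd hσ hσp he (by linarith) (by linarith)

lemma exists_lintegral_dominator_lt_top (hd : 1 ≤ d) {s p q α β : ℝ} (hs0 : 0 < s) (hs1 : s < 1)
    (hq : 1 ≤ q) (hqp : q ≤ p) (hα : α < s * q - (1 - q / p) * (d : ℝ)) (hβ : β < s * p)
    (hα' : -(d : ℝ) < α) (hβ' : -(d : ℝ) < β) {e : 𝔼} (he : ‖e‖ = 1) :
    ∃ δ : ℝ, 0 < δ ∧ ∫⁻ z : 𝔼,
      ENNReal.ofReal (dominator (((d : ℝ) + α + q * β / p - s * q) / q) δ ‖z‖) ^ p *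
        unitKernel d (s * p) β e z < ∞ := by
  have hq0 : 0 < q := by linarith
  have hp0 : 0 < p := by linarith
  set a := ((d : ℝ) + α + q * β / p - s * q) / q with ha
  have hpa : β - p * a = s * p - p / q * (d + α) := by
    rw [ha]
    field_simp
    ring
  have g1 : 0 < p / q * (d + α) := mul_pos (by positivity) (by linarith)
  have g2 : 0 < s * p - p / q * (d + α) + d := by
    have h : p / q * α < p / q * (s * q - (1 - q / p) * (d : ℝ)) :=
      mul_lt_mul_of_pos_left hα (by positivity)
    have h' : p / q * (s * q - (1 - q / p) * (d : ℝ)) = s * p - p / q * d + d := by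
      field_simp
      ring
    linarith
  obtain ⟨ε, hε, hε'⟩ : ∃ ε, 0 < ε ∧ ε < min (min (β + d) (s * p - β))
      (min (s * p - p / q * (d + α) + d) (p / q * (d + α))) :=
    exists_between (lt_min (lt_min (by linarith) (by linarith)) (lt_min g2 g1))
  rw [lt_min_iff, lt_min_iff, lt_min_iff] at hε'
  obtain ⟨⟨e1, e2⟩, e3, e4⟩ := hε'
  have hpε : p * (ε / p) = ε := by field_simp
  refine ⟨ε / p, by positivity, lintegral_dominator_lt_top hd (by positivity) (by nlinarith) he
    (by positivity) ?_ ?_ ?_ ?_⟩ <;> (try rw [hpa]) <;> rw [hpε] <;> linarith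

lemma groundIntegral_lt_top (hd : 1 ≤ d) {σ p a β δ : ℝ} (hp : 0 ≤ p) {e : 𝔼}
    (h : ∫⁻ z : 𝔼, ENNReal.ofReal (dominator a δ ‖z‖) ^ p * unitKernel d σ β e z < ∞) :
    groundIntegral d σ p a β e < ∞ := by
  have := nontrivial_euclideanSpace hd
  have h1 : groundIntegral d σ p a β e ≤ ∫⁻ z : 𝔼, ENNReal.ofReal (1 + |a|) ^ p *
      (ENNReal.ofReal (dominator a δ ‖z‖) ^ p * unitKernel d σ β e z) := by
    refine lintegral_mono_ae ?_
    filter_upwards [Measure.ae_ne volume (0 : 𝔼)] with z hz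
    rw [← mul_assoc, ← ENNReal.mul_rpow_of_nonneg _ _ hp, ← ENNReal.ofReal_mul (by positivity)]
    gcongr
    exact abs_one_sub_rpow_le_dominator (norm_pos_iff.2 hz) a δ
  refine h1.trans_lt ?_
  have h2 : ENNReal.ofReal (1 + |a|) ^ p ≠ ∞ :=
    ENNReal.rpow_ne_top_of_nonneg hp ENNReal.ofReal_ne_top
  rw [lintegral_const_mul' _ _ h2]
  exact ENNReal.mul_lt_top h2.lt_top h

lemma hardyIntegral_lt_top_of_le (hd : 1 ≤ d) {s p q α β : ℝ} (hq : 0 < q) {u : 𝔼 → ℝ}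
    (hu : HasCompactSupport u) {C η : ℝ} (hC : 0 ≤ C) (hη : -(d : ℝ) < η)
    (h : ∀ x, |u x| ^ q / ‖x‖ ^ (s * q - α - q * β / p) ≤ C * ‖x‖ ^ η) :
    hardyIntegral d s p q α β u < ∞ := by
  obtain ⟨R, -, hR⟩ := (IsCompact.isBounded (s := tsupport u) hu).exists_pos_norm_lt
  have hm : MeasurableSet {x : 𝔼 | ‖x‖ ∈ Iio R} := measurable_norm measurableSet_Iio
  have h1 := setLIntegral_const_mul_ofReal_lt_top hC hm (fun x _ ↦ h x)
    (setLIntegral_ball_rpow_norm_lt_top hd hη R)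
  refine lt_of_eq_of_lt ?_ h1
  rw [← lintegral_indicator hm, hardyIntegral]
  refine lintegral_congr fun x ↦ ?_
  by_cases hx : x ∈ {x : 𝔼 | ‖x‖ ∈ Iio R}
  · rw [indicator_of_mem hx]
  · have : u x = 0 := by
      by_contra hne
      exact hx (hR x (subset_tsupport u hne))
    rw [indicator_of_notMem hx, this, abs_zero, Real.zero_rpow hq.ne', zero_div,
      ENNReal.ofReal_zero]

lemma exists_abs_le_of_mem_CcOne {U : Set 𝔼} {u : 𝔼 → ℝ} (hu : u ∈ CcOne d U) :
    ∃ M, 0 ≤ M ∧ ∀ x, |u x| ≤ M := by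
  obtain ⟨M, hM⟩ := hu.2.1.exists_bound_of_continuous hu.1.continuous
  exact ⟨M, (norm_nonneg _).trans (hM 0), hM⟩

lemma hardyIntegral_lt_top (hd : 1 ≤ d) {s p q α β : ℝ} (hq : 0 < q)
    (hγ : s * q - α - q * β / p < d) {u : 𝔼 → ℝ} (hu : u ∈ CcOne d univ) :
    hardyIntegral d s p q α β u < ∞ := by
  obtain ⟨M, hM0, hM⟩ := exists_abs_le_of_mem_CcOne hu
  refine hardyIntegral_lt_top_of_le hd hq hu.2.1 (C := M ^ q) (by positivity)
    (η := -(s * q - α - q * β / p)) (by linarith) fun x ↦ ?_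
  rw [Real.rpow_neg (norm_nonneg _), ← div_eq_mul_inv]
  gcongr
  exact hM x

lemma hardyIntegral_lt_top_of_punctured (hd : 1 ≤ d) {s p q α β : ℝ} (hq : 0 < q)
    (hγ : d < s * q - α - q * β / p) {u : 𝔼 → ℝ} (hu : u ∈ CcOne d {0}ᶜ) :
    hardyIntegral d s p q α β u < ∞ := by
  obtain ⟨M, hM0, hM⟩ := exists_abs_le_of_mem_CcOne hu
  have h0 : (0 : 𝔼) ∈ (tsupport u)ᶜ := fun h ↦ hu.2.2 h rfl
  obtain ⟨r, hr, hball⟩ := Metric.isOpen_iff.1 (isClosed_tsupport u).isOpen_compl 0 h0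
  have hd0 : (0 : ℝ) < d := by exact_mod_cast hd
  refine hardyIntegral_lt_top_of_le hd hq hu.2.1 (C := M ^ q / r ^ (s * q - α - q * β / p))
    (by positivity) (η := 0) (by linarith) fun x ↦ ?_
  rw [Real.rpow_zero, mul_one]
  by_cases hx : ‖x‖ < r
  · have : u x = 0 := image_eq_zero_of_notMem_tsupport (hball (by simpa using hx))
    rw [this, abs_zero, Real.zero_rpow hq.ne', zero_div]
    positivity
  · push Not at hx
    have := hM x
    gcongr
    linarith

end Domination

section Slices

lemma sphereMass_succ_eq (n : ℕ) : sphereMass (n + 1) = ENNReal.ofReal (sphereArea n) := by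
  have hx : (0 : ℝ) < ((n : ℝ) + 1) / 2 := by positivity
  have hG : 0 < Real.Gamma (((n : ℝ) + 1) / 2) := Real.Gamma_pos_of_pos hx
  rw [sphereMass, EuclideanSpace.volume_ball, sphereArea, ENNReal.ofReal_one, one_pow, one_mul,
    ← ENNReal.ofReal_natCast, ← ENNReal.ofReal_mul (by positivity), Fintype.card_fin,
    Nat.cast_add, Nat.cast_one, Real.Gamma_add_one hx.ne', Real.sqrt_eq_rpow,
    ← Real.rpow_natCast, ← Real.rpow_mul Real.pi_pos.le]
  congr 1
  push_cast
  have : 1 / 2 * ((n : ℝ) + 1) = ((n : ℝ) + 1) / 2 := by ring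
  rw [this]
  field_simp

lemma lintegral_euclideanSpace_succ {n : ℕ} {f : ℝ → ℝ → ℝ≥0∞}
    (hf : Measurable (Function.uncurry f)) :
    ∫⁻ y : EuclideanSpace ℝ (Fin (n + 1)), f ‖y‖ (y 0) =
      ∫⁻ c : ℝ, ∫⁻ y : EuclideanSpace ℝ (Fin n), f (√(c ^ 2 + ‖y‖ ^ 2)) c := by
  have h1 := (volume_preserving_piFinSuccAbove (fun _ : Fin (n + 1) ↦ ℝ) 0).comp
    (PiLp.volume_preserving_ofLp (Fin (n + 1)))
  have h2 : MeasurePreserving (Prod.map id (WithLp.toLp 2) :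
      ℝ × (Fin n → ℝ) → ℝ × EuclideanSpace ℝ (Fin n)) :=
    (MeasurePreserving.id volume).prod (PiLp.volume_preserving_toLp (Fin n))
  have h3 := h2.comp h1
  have mF : Measurable fun w : ℝ × EuclideanSpace ℝ (Fin n) ↦ f (√(w.1 ^ 2 + ‖w.2‖ ^ 2)) w.1 :=
    hf.comp (Measurable.prodMk (by fun_prop) measurable_fst)
  have h4 := lintegral_prod _ mF.aemeasurable (μ := (volume : Measure ℝ))
    (ν := (volume : Measure (EuclideanSpace ℝ (Fin n))))
  rw [← h4]
  refine Eq.trans ?_ (h3.lintegral_comp mF)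
  refine lintegral_congr fun y ↦ ?_
  have h5 : ‖y‖ = √(y 0 ^ 2 + ‖(WithLp.toLp 2 fun j : Fin n ↦ y j.succ :
      EuclideanSpace ℝ (Fin n))‖ ^ 2) := by
    rw [EuclideanSpace.norm_sq_eq, EuclideanSpace.norm_eq, Fin.sum_univ_succ]
    simp
  rw [h5]
  rfl

lemma setLIntegral_Ioo_comp_cos (g : ℝ → ℝ≥0∞) :
    ∫⁻ r in Ioo (-1 : ℝ) 1, g r =
      ∫⁻ θ in Ioo 0 Real.pi, ENNReal.ofReal (Real.sin θ) * g (Real.cos θ) := by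
  rw [Measure.restrict_congr_set Ioo_ae_eq_Icc, ← Real.bijOn_cos.image_eq,
    lintegral_image_eq_lintegral_abs_deriv_mul measurableSet_Icc
      (fun θ _ ↦ (Real.hasDerivAt_cos θ).hasDerivWithinAt) Real.injOn_cos,
    Measure.restrict_congr_set Ioo_ae_eq_Icc.symm]
  refine setLIntegral_congr_fun measurableSet_Ioo fun θ hθ ↦ ?_
  rw [abs_neg, abs_of_nonneg (Real.sin_pos_of_mem_Ioo hθ).le]

lemma lintegral_halfPlane_polar {F : ℝ → ℝ → ℝ≥0∞} (hF : Measurable (Function.uncurry F)) :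
    ∫⁻ c : ℝ, ∫⁻ ρ in Ioi (0 : ℝ), F c ρ =
      ∫⁻ t in Ioi (0 : ℝ), ENNReal.ofReal t *
        ∫⁻ θ in Ioo 0 Real.pi, F (t * Real.cos θ) (t * Real.sin θ) := by
  set G : ℝ × ℝ → ℝ≥0∞ := (univ ×ˢ Ioi (0 : ℝ)).indicator (Function.uncurry F) with hG
  have mG : Measurable G := hF.indicator (MeasurableSet.univ.prod measurableSet_Ioi)
  have h1 : ∫⁻ c : ℝ, ∫⁻ ρ in Ioi (0 : ℝ), F c ρ = ∫⁻ w, G w := by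
    rw [Measure.volume_eq_prod, lintegral_prod _ mG.aemeasurable]
    refine lintegral_congr fun c ↦ ?_
    rw [← lintegral_indicator measurableSet_Ioi]
    refine lintegral_congr fun ρ ↦ ?_
    simp [hG, indicator]
  have mP : Measurable fun w : ℝ × ℝ ↦ G (w.1 * Real.cos w.2, w.1 * Real.sin w.2) :=
    mG.comp (by fun_prop)
  rw [h1, ← lintegral_comp_polarCoord_symm, polarCoord_target, Measure.volume_eq_prod,
    ← Measure.prod_restrict, lintegral_prod _ (by
      simp only [polarCoord_symm_apply, smul_eq_mul]
      exact (measurable_fst.ennreal_ofReal.mul mP).aemeasurable)]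
  refine setLIntegral_congr_fun measurableSet_Ioi fun t (ht : 0 < t) ↦ ?_
  simp only [polarCoord_symm_apply, smul_eq_mul]
  rw [lintegral_const_mul' _ _ ENNReal.ofReal_ne_top]
  congr 1
  rw [← lintegral_indicator measurableSet_Ioo, ← lintegral_indicator measurableSet_Ioo]
  refine lintegral_congr fun θ ↦ ?_
  by_cases hθ : θ ∈ Ioo 0 Real.pi
  · have h2 : 0 < t * Real.sin θ := mul_pos ht (Real.sin_pos_of_mem_Ioo hθ)
    have h3 : θ ∈ Ioo (-Real.pi) Real.pi := ⟨by linarith [hθ.1, Real.pi_pos], hθ.2⟩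
    rw [indicator_of_mem h3, indicator_of_mem hθ, hG, indicator_of_mem (by simpa using h2)]
    rfl
  · rw [indicator_of_notMem hθ]
    by_cases h3 : θ ∈ Ioo (-Real.pi) Real.pi
    · have h4 : θ ≤ 0 := by
        by_contra h
        exact hθ ⟨by linarith, h3.2⟩
      have h5 : t * Real.sin θ ≤ 0 := mul_nonpos_of_nonneg_of_nonpos ht.le
        (Real.sin_nonpos_of_nonpos_of_neg_pi_le h4 h3.1.le)
      rw [indicator_of_mem h3, hG, indicator_of_notMem (by simpa using h5)]
    · rw [indicator_of_notMem h3]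

/-- Integration over `ℝ^(n+2)` of a function of the norm and of one coordinate. -/
lemma lintegral_norm_coord {n : ℕ} {f : ℝ → ℝ → ℝ≥0∞} (hf : Measurable (Function.uncurry f)) :
    ∫⁻ y : EuclideanSpace ℝ (Fin (n + 2)), f ‖y‖ (y 0) =
      ENNReal.ofReal (sphereArea n) * ∫⁻ t in Ioi (0 : ℝ), ENNReal.ofReal (t ^ ((n : ℝ) + 1)) *
        ∫⁻ r in Ioo (-1 : ℝ) 1, ENNReal.ofReal ((1 - r ^ 2) ^ (((n : ℝ) - 1) / 2)) *
          f t (t * r) := by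
  rw [lintegral_euclideanSpace_succ hf]
  have mF : Measurable (Function.uncurry fun c ρ : ℝ ↦
      ENNReal.ofReal (ρ ^ (n : ℝ)) * f (√(c ^ 2 + ρ ^ 2)) c) :=
    Measurable.mul (by fun_prop) (hf.comp (Measurable.prodMk (by fun_prop) measurable_fst))
  have h1 : ∀ c : ℝ, ∫⁻ y : EuclideanSpace ℝ (Fin (n + 1)), f (√(c ^ 2 + ‖y‖ ^ 2)) c =
      ENNReal.ofReal (sphereArea n) * ∫⁻ ρ in Ioi (0 : ℝ), ENNReal.ofReal (ρ ^ (n : ℝ)) *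
        f (√(c ^ 2 + ρ ^ 2)) c := by
    intro c
    have := lintegral_norm_euclideanSpace (d := n + 1) (by omega)
      (f := fun ρ ↦ f (√(c ^ 2 + ρ ^ 2)) c)
      (hf.comp (Measurable.prodMk (by fun_prop) measurable_const))
    rw [this, sphereMass_succ_eq]
    simp
  simp_rw [h1]
  rw [lintegral_const_mul' _ _ ENNReal.ofReal_ne_top, lintegral_halfPlane_polar mF]
  congr 1
  refine setLIntegral_congr_fun measurableSet_Ioi fun t (ht : 0 < t) ↦ ?_
  rw [setLIntegral_Ioo_comp_cos, ← lintegral_const_mul' _ _ ENNReal.ofReal_ne_top,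
    ← lintegral_const_mul' _ _ ENNReal.ofReal_ne_top]
  refine setLIntegral_congr_fun measurableSet_Ioo fun θ hθ ↦ ?_
  have hsin := Real.sin_pos_of_mem_Ioo hθ
  have h2 : √((t * Real.cos θ) ^ 2 + (t * Real.sin θ) ^ 2) = t := by
    rw [mul_pow, mul_pow, ← mul_add, Real.cos_sq_add_sin_sq, mul_one, Real.sqrt_sq ht.le]
  have h3 : (1 - Real.cos θ ^ 2) ^ (((n : ℝ) - 1) / 2) = Real.sin θ ^ ((n : ℝ) - 1) := by
    rw [← Real.sin_sq, ← Real.rpow_natCast, ← Real.rpow_mul hsin.le]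
    congr 1
    push_cast
    ring
  rw [h2, h3, ← mul_assoc, ← mul_assoc, ← mul_assoc, ← ENNReal.ofReal_mul ht.le,
    ← ENNReal.ofReal_mul (by positivity), ← ENNReal.ofReal_mul (by positivity)]
  congr 2
  rw [Real.mul_rpow ht.le hsin.le, Real.rpow_add_one ht.ne', Real.rpow_sub_one hsin.ne']
  field_simp

end Slices

section Constant

lemma lintegral_euclideanSpace_one {f : ℝ → ℝ → ℝ≥0∞} (hf : Measurable (Function.uncurry f)) :
    ∫⁻ y : EuclideanSpace ℝ (Fin 1), f ‖y‖ (y 0) =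
      ∫⁻ t in Ioi (0 : ℝ), (f t t + f t (-t)) := by
  have h1 := lintegral_euclideanSpace_succ (n := 0) hf
  rw [h1]
  have h2 : ∀ c : ℝ, ∫⁻ y : EuclideanSpace ℝ (Fin 0), f (√(c ^ 2 + ‖y‖ ^ 2)) c = f |c| c := by
    intro c
    rw [volume_euclideanSpace_eq_dirac, lintegral_dirac]
    simp [Real.sqrt_sq_eq_abs]
  simp_rw [h2]
  have m1 : Measurable fun t ↦ f t t := hf.comp (measurable_id.prodMk measurable_id)
  rw [lintegral_add_left m1, ← lintegral_add_compl _ measurableSet_Ioi (A := Ioi (0 : ℝ))]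
  congr 1
  · refine setLIntegral_congr_fun measurableSet_Ioi fun t (ht : 0 < t) ↦ ?_
    rw [abs_of_pos ht]
  · rw [compl_Ioi, Measure.restrict_congr_set Iio_ae_eq_Iic.symm,
      ← lintegral_indicator measurableSet_Iio, ← lintegral_indicator measurableSet_Ioi,
      ← lintegral_neg_eq_self]
    refine lintegral_congr fun t ↦ ?_
    by_cases ht : 0 < t
    · simp [ht, abs_of_pos ht]
    · simp [ht]

lemma setLIntegral_Ioi_zero_eq {F : ℝ → ℝ≥0∞} (hF : Measurable F) :
    ∫⁻ t in Ioi (0 : ℝ), F t =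
      ∫⁻ t in Ioo (0 : ℝ) 1, (F t + ENNReal.ofReal (t ^ (-2 : ℝ)) * F t⁻¹) := by
  have himg : (fun t : ℝ ↦ t⁻¹) '' Ioo 0 1 = Ioi 1 := by
    ext x
    constructor
    · rintro ⟨t, ht, rfl⟩
      exact (one_lt_inv₀ ht.1).2 ht.2
    · intro (hx : 1 < x)
      exact ⟨x⁻¹, ⟨by positivity, inv_lt_one_of_one_lt₀ hx⟩, inv_inv x⟩
  rw [lintegral_add_left hF]
  have h1 : Ioi (0 : ℝ) = Ioc 0 1 ∪ Ioi 1 := (Ioc_union_Ioi_eq_Ioi zero_le_one).symm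
  rw [h1, lintegral_union measurableSet_Ioi Ioc_disjoint_Ioi_same,
    Measure.restrict_congr_set Ioo_ae_eq_Ioc.symm]
  congr 1
  rw [← himg, lintegral_image_eq_lintegral_abs_deriv_mul measurableSet_Ioo
    (fun t ht ↦ (hasDerivAt_inv ht.1.ne').hasDerivWithinAt) inv_injective.injOn]
  refine setLIntegral_congr_fun measurableSet_Ioo fun t ht ↦ ?_
  have h0 : 0 < t := ht.1
  rw [abs_neg, abs_of_nonneg (by positivity), Real.rpow_neg h0.le]
  norm_cast

/-- The kernel `Phi` on the whole half-line. -/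
noncomputable def extendedPhi (d : ℕ) (s p t : ℝ) : ℝ≥0∞ :=
  if d = 1 then ENNReal.ofReal (|1 - t| ^ (-1 - s * p) + (1 + t) ^ (-1 - s * p)) else Phi d s p t

lemma extendedPhi_eq {d : ℕ} {s p t : ℝ} (ht : t < 1) : extendedPhi d s p t = Phi d s p t := by
  unfold extendedPhi
  split_ifs with h
  · rw [Phi, if_pos h, abs_of_pos (by linarith)]
  · rfl

lemma measurable_extendedPhi {d : ℕ} {s p : ℝ} : Measurable (extendedPhi d s p) := by
  unfold extendedPhi
  split_ifs with h
  · fun_prop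
  · simp only [Phi, if_neg h]
    refine Measurable.const_mul (Measurable.lintegral_prod_right'
      (f := fun w : ℝ × ℝ ↦ ENNReal.ofReal ((1 - w.2 ^ 2) ^ (((d : ℝ) - 3) / 2) /
          (1 - 2 * w.1 * w.2 + w.1 ^ 2) ^ (((d : ℝ) + s * p) / 2))) ?_) _
    fun_prop

lemma extendedPhi_inv {d : ℕ} {s p t : ℝ} (ht : 0 < t) :
    extendedPhi d s p t⁻¹ = ENNReal.ofReal (t ^ ((d : ℝ) + s * p)) * extendedPhi d s p t := by
  unfold extendedPhi
  split_ifs with h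
  · rw [← ENNReal.ofReal_mul (by positivity)]
    congr 1
    have h1 : |1 - t⁻¹| = t⁻¹ * |1 - t| := by
      rw [← abs_of_pos (inv_pos.2 ht), ← abs_mul, abs_of_pos (inv_pos.2 ht), abs_sub_comm]
      congr 1
      field_simp
    have h2 : 1 + t⁻¹ = t⁻¹ * (1 + t) := by
      field_simp
      ring
    have h3 : t ^ ((d : ℝ) + s * p) = t⁻¹ ^ (-1 - s * p) := by
      rw [Real.inv_rpow ht.le, ← Real.rpow_neg ht.le, h]
      congr 1
      push_cast
      ring
    rw [h1, h2, Real.mul_rpow (by positivity) (abs_nonneg _),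
      Real.mul_rpow (by positivity) (by positivity), h3]
    ring
  · simp only [Phi, if_neg h]
    rw [mul_left_comm]
    congr 1
    rw [← lintegral_const_mul' _ _ ENNReal.ofReal_ne_top]
    refine setLIntegral_congr_fun measurableSet_Ioo fun r hr ↦ ?_
    have h4 : 0 ≤ 1 - 2 * t * r + t ^ 2 := by nlinarith [hr.1, hr.2, sq_nonneg (r - t)]
    have h5 : 1 - 2 * t⁻¹ * r + t⁻¹ ^ 2 = t ^ (-2 : ℝ) * (1 - 2 * t * r + t ^ 2) := by
      rw [Real.rpow_neg ht.le, Real.rpow_ofNat]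
      field_simp
      ring
    rw [← ENNReal.ofReal_mul (by positivity), h5, Real.mul_rpow (by positivity) h4,
      ← Real.rpow_mul ht.le]
    have h6 : (-2 : ℝ) * (((d : ℝ) + s * p) / 2) = -((d : ℝ) + s * p) := by ring
    rw [h6, Real.rpow_neg ht.le, div_mul_eq_div_div, div_inv_eq_mul]
    congr 1
    ring

lemma norm_single_sub_sq {d : ℕ} (hd : 0 < d) (z : EuclideanSpace ℝ (Fin d)) :
    ‖EuclideanSpace.single ⟨0, hd⟩ (1 : ℝ) - z‖ ^ 2 = 1 - 2 * z ⟨0, hd⟩ + ‖z‖ ^ 2 := by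
  rw [norm_sub_sq_real, EuclideanSpace.inner_single_left]
  simp

lemma groundIntegral_eq_setLIntegral {d : ℕ} (hd : 0 < d) {s p a β : ℝ} (hp : 0 ≤ p) :
    groundIntegral d (s * p) p a β (EuclideanSpace.single ⟨0, hd⟩ 1) =
      ∫⁻ t in Ioi (0 : ℝ), ENNReal.ofReal (|1 - t ^ (-a)| ^ p * t ^ (β + d - 1)) *
        extendedPhi d s p t := by
  set f : ℝ → ℝ → ℝ≥0∞ := fun t c ↦ ENNReal.ofReal (|1 - t ^ (-a)| ^ p * t ^ β) *
    ENNReal.ofReal ((1 - 2 * c + t ^ 2) ^ (-((d : ℝ) + s * p) / 2)) with hf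
  have mf : Measurable (Function.uncurry f) := by
    simp only [hf, Function.uncurry_def]
    fun_prop
  have h1 : groundIntegral d (s * p) p a β (EuclideanSpace.single ⟨0, hd⟩ 1) =
      ∫⁻ z : EuclideanSpace ℝ (Fin d), f ‖z‖ (z ⟨0, hd⟩) := by
    refine lintegral_congr fun z ↦ ?_
    have h2 : ‖EuclideanSpace.single ⟨0, hd⟩ (1 : ℝ) - z‖ ^ ((d : ℝ) + s * p) =
        ((1 - 2 * z ⟨0, hd⟩ + ‖z‖ ^ 2) ^ (-((d : ℝ) + s * p) / 2))⁻¹ := by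
      rw [← norm_single_sub_sq hd z, ← Real.rpow_natCast, ← Real.rpow_mul (norm_nonneg _),
        ← Real.rpow_neg (norm_nonneg _)]
      congr 1
      push_cast
      ring
    have h3 : 0 ≤ 1 - 2 * z ⟨0, hd⟩ + ‖z‖ ^ 2 := by
      rw [← norm_single_sub_sq hd z]
      positivity
    rw [unitKernel, h2, div_inv_eq_mul, ENNReal.ofReal_rpow_of_nonneg (abs_nonneg _) hp,
      ← ENNReal.ofReal_mul (by positivity), hf]
    simp only
    rw [← ENNReal.ofReal_mul (by positivity), mul_assoc]
  rw [h1]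
  obtain ⟨n, rfl⟩ : ∃ n, d = n + 1 := ⟨d - 1, by omega⟩
  rcases n with _ | n
  · have h2 := lintegral_euclideanSpace_one mf
    refine h2.trans (setLIntegral_congr_fun measurableSet_Ioi fun t (ht : 0 < t) ↦ ?_)
    have h3 : 1 - 2 * t + t ^ 2 = |1 - t| ^ 2 := by rw [sq_abs]; ring
    have h4 : 1 - 2 * -t + t ^ 2 = (1 + t) ^ 2 := by ring
    have h5 : ∀ x : ℝ, 0 ≤ x → (x ^ 2) ^ (-(((0 + 1 : ℕ) : ℝ) + s * p) / 2) =
        x ^ (-1 - s * p) := by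
      intro x hx
      rw [← Real.rpow_natCast, ← Real.rpow_mul hx]
      congr 1
      push_cast
      ring
    simp only [hf]
    rw [h3, h4, h5 _ (abs_nonneg _), h5 _ (by positivity), ← mul_add,
      ← ENNReal.ofReal_add (by positivity) (by positivity), extendedPhi, if_pos (by simp)]
    congr 4
    push_cast
    ring
  · have h2 := lintegral_norm_coord (n := n) mf
    refine h2.trans ?_
    rw [← lintegral_const_mul' _ _ ENNReal.ofReal_ne_top]
    refine setLIntegral_congr_fun measurableSet_Ioi fun t (ht : 0 < t) ↦ ?_
    have hne : n + 1 + 1 ≠ 1 := by omega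
    rw [extendedPhi, if_neg hne, Phi, if_neg hne]
    have h3 : (((n + 1 + 1 : ℕ) : ℝ) - 2) = n := by push_cast; ring
    have h4 : (((n + 1 + 1 : ℕ) : ℝ) - 3) / 2 = ((n : ℝ) - 1) / 2 := by push_cast; ring
    have h6 : |1 - t ^ (-a)| ^ p * t ^ (β + ((n + 1 + 1 : ℕ) : ℝ) - 1) =
        |1 - t ^ (-a)| ^ p * t ^ β * t ^ ((n : ℝ) + 1) := by
      rw [mul_assoc, ← Real.rpow_add ht]
      congr 2
      push_cast
      ring
    rw [h3, h4, h6, ENNReal.ofReal_mul (q := t ^ ((n : ℝ) + 1)) (by positivity)]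
    have h7 : ∀ r ∈ Ioo (-1 : ℝ) 1, ENNReal.ofReal ((1 - r ^ 2) ^ (((n : ℝ) - 1) / 2)) *
        f t (t * r) = ENNReal.ofReal (|1 - t ^ (-a)| ^ p * t ^ β) *
          ENNReal.ofReal ((1 - r ^ 2) ^ (((n : ℝ) - 1) / 2) /
          (1 - 2 * t * r + t ^ 2) ^ ((((n + 1 + 1 : ℕ) : ℝ) + s * p) / 2)) := by
      intro r hr
      have h8 : 0 ≤ 1 - 2 * t * r + t ^ 2 := by nlinarith [hr.1, hr.2, sq_nonneg (r - t)]
      have h9 : 0 ≤ 1 - r ^ 2 := by nlinarith [hr.1, hr.2]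
      simp only [hf]
      rw [mul_left_comm, ← ENNReal.ofReal_mul (by positivity), ← mul_assoc 2 t r, neg_div,
        Real.rpow_neg h8, ← div_eq_mul_inv]
    rw [setLIntegral_congr_fun measurableSet_Ioo h7,
      lintegral_const_mul' _ _ ENNReal.ofReal_ne_top]
    ring

theorem hardyConst_eq_groundIntegral_rpow {d : ℕ} (hd : 0 < d) {s p q α β : ℝ} (hp : 0 < p)
    (hq : 0 < q) :
    hardyConst d s p q α β =
      groundIntegral d (s * p) p (((d : ℝ) + α + q * β / p - s * q) / q) β
        (EuclideanSpace.single ⟨0, hd⟩ 1) ^ (q / p) := by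
  generalize ha : ((d : ℝ) + α + q * β / p - s * q) / q = a
  rw [hardyConst, groundIntegral_eq_setLIntegral hd hp.le, ha]
  have mF : Measurable fun t ↦ ENNReal.ofReal (|1 - t ^ (-a)| ^ p * t ^ (β + d - 1)) *
        extendedPhi d s p t := Measurable.mul (by fun_prop) measurable_extendedPhi
  rw [setLIntegral_Ioi_zero_eq mF]
  congr 1
  refine setLIntegral_congr_fun measurableSet_Ioo fun t ht ↦ ?_
  have h0 : 0 < t := ht.1
  have h1 : |1 - t ^ (-a)| ^ p = t ^ (-(a * p)) * |1 - t ^ a| ^ p := by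
    have : 1 - t ^ (-a) = t ^ (-a) * (t ^ a - 1) := by
      rw [mul_sub, ← Real.rpow_add h0]
      simp
    rw [this, abs_mul, abs_sub_comm, abs_of_pos (Real.rpow_pos_of_pos h0 _),
      Real.mul_rpow (by positivity) (abs_nonneg _), ← Real.rpow_mul h0.le, neg_mul]
  have h2 : t⁻¹ ^ (-a) = t ^ a := by
    rw [Real.inv_rpow h0.le, Real.rpow_neg h0.le, inv_inv]
  have h3 : t⁻¹ ^ (β + d - 1) = t ^ (-(β + d - 1)) := by
    rw [Real.inv_rpow h0.le, Real.rpow_neg h0.le]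
  rw [extendedPhi_inv h0, extendedPhi_eq ht.2, h1, h2, h3, ← mul_assoc, ← mul_assoc,
    ← ENNReal.ofReal_mul (by positivity), ← ENNReal.ofReal_mul (by positivity), ← add_mul,
    ← ENNReal.ofReal_add (by positivity) (by positivity)]
  congr 2
  have h4 : t ^ (s * p - 1) * t ^ (-(p / q - 1) * (d : ℝ) - p * α / q) =
      t ^ (-(a * p)) * t ^ (β + d - 1) := by
    rw [← Real.rpow_add h0, ← Real.rpow_add h0, ← ha]
    congr 1
    field_simp
    ring
  have h5 : t ^ (s * p - 1) * t ^ (-β) =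
      t ^ (-2 : ℝ) * t ^ (-(β + d - 1)) * t ^ ((d : ℝ) + s * p) := by
    rw [← Real.rpow_add h0, ← Real.rpow_add h0, ← Real.rpow_add h0]
    congr 1
    ring
  rw [mul_add, h4, h5]
  ring

end Constant

section Cutoff

open Filter Topology

/-- A smooth cutoff on the line, equal to `1` on `[-1, 1]` and vanishing off `(-2, 2)`. -/
noncomputable def cutoff : ℝ → ℝ :=
  (⟨1, 2, one_pos, one_lt_two⟩ : ContDiffBump (0 : ℝ))

lemma cutoff_contDiff {n : ℕ∞} : ContDiff ℝ n cutoff := ContDiffBump.contDiff _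

@[fun_prop]
lemma cutoff_continuous : Continuous cutoff := ContDiffBump.continuous _

@[fun_prop]
lemma cutoff_measurable : Measurable cutoff := cutoff_continuous.measurable

lemma cutoff_nonneg (τ : ℝ) : 0 ≤ cutoff τ := ContDiffBump.nonneg _

lemma cutoff_le_one (τ : ℝ) : cutoff τ ≤ 1 := ContDiffBump.le_one _

lemma cutoff_eq_one {τ : ℝ} (h : |τ| ≤ 1) : cutoff τ = 1 :=
  ContDiffBump.one_of_mem_closedBall _ (by simpa [Real.norm_eq_abs] using h)

lemma cutoff_eq_zero {τ : ℝ} (h : 2 ≤ |τ|) : cutoff τ = 0 :=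
  ContDiffBump.zero_of_le_dist _ (by simpa [Real.dist_eq] using h)

lemma exists_abs_cutoff_sub_le : ∃ K : ℝ, 0 ≤ K ∧ ∀ x y, |cutoff x - cutoff y| ≤ K * |x - y| := by
  obtain ⟨K, hK⟩ := ContDiff.lipschitzWith_of_hasCompactSupport
    (ContDiffBump.hasCompactSupport (⟨1, 2, one_pos, one_lt_two⟩ : ContDiffBump (0 : ℝ)))
    (cutoff_contDiff (n := 1)) one_ne_zero
  exact ⟨K, K.2, fun x y ↦ hK.dist_le_mul x y⟩

lemma cutoff_le_exp {δ : ℝ} (hδ : 0 ≤ δ) (τ : ℝ) :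
    cutoff τ ≤ Real.exp (2 * δ) * Real.exp (-(δ * |τ|)) := by
  rw [← Real.exp_add]
  rcases le_total 2 |τ| with h | h
  · rw [cutoff_eq_zero h]
    positivity
  · refine (cutoff_le_one τ).trans (Real.one_le_exp ?_)
    nlinarith

lemma exp_mul_abs_log_le {t δ : ℝ} (ht : 0 < t) : Real.exp (δ * |Real.log t|) ≤ t ^ δ + t ^ (-δ) := by
  rw [Real.rpow_def_of_pos ht, Real.rpow_def_of_pos ht]
  rcases abs_cases (Real.log t) with ⟨h, _⟩ | ⟨h, _⟩ <;> rw [h]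
  · rw [mul_comm]
    have := Real.exp_pos (Real.log t * -δ)
    linarith
  · have h1 : δ * -Real.log t = Real.log t * -δ := by ring
    rw [h1]
    have := Real.exp_pos (Real.log t * δ)
    linarith

lemma abs_cutoff_sub_le {K δ : ℝ} (hK0 : 0 ≤ K) (hK : ∀ x y, |cutoff x - cutoff y| ≤ K * |x - y|)
    (hδ : 0 ≤ δ) (τ L h : ℝ) (hh : |h| ≤ |L|) :
    |cutoff (τ + h) - cutoff τ| ≤ (1 + K) * min 1 |L| * Real.exp (2 * δ) *
      Real.exp (-(δ * |τ|)) * Real.exp (δ * |L|) := by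
  have h1 : |cutoff (τ + h) - cutoff τ| ≤ (1 + K) * min 1 |L| := by
    have e1 : |cutoff (τ + h) - cutoff τ| ≤ 1 := by
      rw [abs_le]
      constructor <;>
      linarith [cutoff_nonneg τ, cutoff_nonneg (τ + h), cutoff_le_one τ, cutoff_le_one (τ + h)]
    have e2 : |cutoff (τ + h) - cutoff τ| ≤ K * |L| := by
      refine (hK _ _).trans ?_
      rw [add_sub_cancel_left]
      gcongr
    rcases min_cases 1 |L| with ⟨e, _⟩ | ⟨e, _⟩ <;> rw [e]
    · linarith
    · nlinarith [abs_nonneg L]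
  by_cases h2 : |τ| ≤ 2 + |L|
  · have h3 : 1 ≤ Real.exp (2 * δ) * Real.exp (-(δ * |τ|)) * Real.exp (δ * |L|) := by
      rw [← Real.exp_add, ← Real.exp_add]
      refine Real.one_le_exp ?_
      nlinarith
    calc _ ≤ _ := h1
      _ ≤ (1 + K) * min 1 |L| *
          (Real.exp (2 * δ) * Real.exp (-(δ * |τ|)) * Real.exp (δ * |L|)) :=
        le_mul_of_one_le_right (by positivity) h3
      _ = _ := by ring
  · push Not at h2
    have h4 : |τ| ≤ |τ + h| + |h| := by
      have := abs_sub (τ + h) h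
      rwa [add_sub_cancel_right] at this
    rw [cutoff_eq_zero (by linarith), cutoff_eq_zero (by linarith [abs_nonneg L]), sub_self,
      abs_zero]
    positivity

lemma exists_cutoff_difference_le (a : ℝ) {δ : ℝ} (hδ : 0 ≤ δ) :
    ∃ C : ℝ, 0 ≤ C ∧ ∀ τ t N : ℝ, 0 < t → 1 ≤ N →
      |cutoff τ - t ^ (-a) * cutoff (τ + Real.log t / N)| ≤
        C * Real.exp (-(δ * |τ|)) * dominator a δ t := by
  obtain ⟨K, hK0, hK⟩ := exists_abs_cutoff_sub_le
  refine ⟨Real.exp (2 * δ) * (1 + |a| + (1 + K)), by positivity, fun τ t N ht hN ↦ ?_⟩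
  have hh : |Real.log t / N| ≤ |Real.log t| := by
    rw [abs_div, abs_of_pos (by linarith : 0 < N)]
    exact div_le_self (abs_nonneg _) hN
  have h1 := abs_one_sub_rpow_le_dominator ht a δ
  have h2 := cutoff_le_exp hδ τ
  have h3 := abs_cutoff_sub_le hK0 hK hδ τ _ _ hh
  have h4 := exp_mul_abs_log_le ht (δ := δ)
  have h5 : 0 < t ^ (-a) := Real.rpow_pos_of_pos ht _
  have hD : 0 ≤ dominator a δ t := dominator_nonneg ht.le
  have h6 : t ^ (-a) * |cutoff (τ + Real.log t / N) - cutoff τ| ≤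
      Real.exp (2 * δ) * (1 + K) * Real.exp (-(δ * |τ|)) * dominator a δ t := by
    calc _ ≤ (1 + t ^ (-a)) * ((1 + K) * min 1 |Real.log t| * Real.exp (2 * δ) *
          Real.exp (-(δ * |τ|)) * (t ^ δ + t ^ (-δ))) := by
          gcongr
          · linarith
          · refine h3.trans ?_
            gcongr
      _ = _ := by
        rw [dominator]
        ring
  have h7 : cutoff τ * |1 - t ^ (-a)| ≤
      Real.exp (2 * δ) * Real.exp (-(δ * |τ|)) * ((1 + |a|) * dominator a δ t) :=
    mul_le_mul h2 h1 (abs_nonneg _) (by positivity)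
  have h8 : cutoff τ - t ^ (-a) * cutoff (τ + Real.log t / N) = cutoff τ * (1 - t ^ (-a)) -
      t ^ (-a) * (cutoff (τ + Real.log t / N) - cutoff τ) := by ring
  rw [h8]
  refine (abs_sub _ _).trans ?_
  rw [abs_mul, abs_mul, abs_of_nonneg (cutoff_nonneg τ), abs_of_pos h5]
  linarith

lemma lintegral_exp_neg_abs_lt_top {b : ℝ} (hb : 0 < b) :
    ∫⁻ τ : ℝ, ENNReal.ofReal (Real.exp (-(b * |τ|))) < ∞ := by
  have h1 : Integrable (fun τ : ℝ ↦ Real.exp (-b * ‖τ‖)) := by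
    rw [integrable_fun_norm_addHaar volume (f := fun r ↦ Real.exp (-b * r))]
    simpa using exp_neg_integrableOn_Ioi 0 hb
  refine lt_of_le_of_lt (lintegral_mono fun τ ↦ ?_) h1.2
  rw [← neg_mul, ← Real.norm_eq_abs]
  exact Real.ofReal_le_enorm _

end Cutoff

section TestFunctions

open Filter Topology

variable {d : ℕ}

local notation "𝔼" => EuclideanSpace ℝ (Fin d)

/-- The power `‖x‖^(-a)` cut off logarithmically at scale `N`. -/
noncomputable def testFunction (d : ℕ) (a N : ℝ) (x : EuclideanSpace ℝ (Fin d)) : ℝ :=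
  ‖x‖ ^ (-a) * cutoff (Real.log ‖x‖ / N)

lemma testFunction_eq_zero {a N : ℝ} (ha : a ≠ 0) (hN : 0 < N) {x : 𝔼}
    (hx : ‖x‖ ∉ Ioo (Real.exp (-(2 * N))) (Real.exp (2 * N))) : testFunction d a N x = 0 := by
  rcases eq_or_ne x 0 with rfl | h0
  · rw [testFunction, norm_zero, Real.zero_rpow (neg_ne_zero.2 ha), zero_mul]
  have ht : 0 < ‖x‖ := norm_pos_iff.2 h0
  rw [testFunction, cutoff_eq_zero, mul_zero]
  rw [abs_div, abs_of_pos hN, le_div_iff₀ hN, le_abs]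
  rw [mem_Ioo, not_and_or, not_lt, not_lt, ← Real.log_le_iff_le_exp ht,
    ← Real.le_log_iff_exp_le ht] at hx
  rcases hx with h | h
  · right; linarith
  · left; linarith

lemma testFunction_mem_CcOne {a N : ℝ} (ha : a ≠ 0) (hN : 0 < N) :
    testFunction d a N ∈ CcOne d {0}ᶜ := by
  have hsub : tsupport (testFunction d a N) ⊆
      Metric.closedBall 0 (Real.exp (2 * N)) \ Metric.ball 0 (Real.exp (-(2 * N))) := by
    refine closure_minimal (fun x hx ↦ ?_) (Metric.isClosed_closedBall.sdiff Metric.isOpen_ball)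
    have h : ‖x‖ ∈ Ioo (Real.exp (-(2 * N))) (Real.exp (2 * N)) := by
      by_contra h
      exact hx (testFunction_eq_zero ha hN h)
    exact ⟨by simpa using h.2.le, by simpa using h.1.le⟩
  refine ⟨?_, ?_, ?_⟩
  · rw [contDiff_iff_contDiffAt]
    intro x
    rcases eq_or_ne x 0 with rfl | h0
    · have h1 : testFunction d a N =ᶠ[𝓝 0] fun _ ↦ 0 := by
        filter_upwards [Metric.ball_mem_nhds (0 : 𝔼) (Real.exp_pos (-(2 * N)))] with y hy
        refine testFunction_eq_zero ha hN fun h ↦ ?_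
        rw [mem_ball_zero_iff] at hy
        exact absurd h.1 (not_lt.2 hy.le)
      exact contDiffAt_const.congr_of_eventuallyEq h1
    · have hn : ContDiffAt ℝ 1 (fun y : 𝔼 ↦ ‖y‖) x := contDiffAt_norm ℝ h0
      have hne : ‖x‖ ≠ 0 := norm_ne_zero_iff.2 h0
      exact (hn.rpow_const_of_ne hne).mul
        ((cutoff_contDiff (n := 1)).contDiffAt.comp x ((hn.log hne).div_const N))
  · exact (isCompact_closedBall (0 : 𝔼) (Real.exp (2 * N))).of_isClosed_subset
      (isClosed_tsupport _) (hsub.trans sdiff_subset)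
  · intro x hx h0
    rw [mem_singleton_iff.1 h0] at hx
    exact (hsub hx).2 (Metric.mem_ball_self (Real.exp_pos _))

/-- Logarithmic polar coordinates. -/
lemma lintegral_log_norm (hd : 1 ≤ d) {N : ℝ} (hN : 0 < N) {φ : ℝ → ℝ≥0∞} (hφ : Measurable φ) :
    ∫⁻ x : 𝔼, ENNReal.ofReal (‖x‖ ^ (-(d : ℝ))) * φ (Real.log ‖x‖ / N) =
      sphereMass d * ENNReal.ofReal N * ∫⁻ τ, φ τ := by
  rw [lintegral_norm_euclideanSpace hd (f := fun r ↦ ENNReal.ofReal (r ^ (-(d : ℝ))) *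
    φ (Real.log r / N)) (by fun_prop), mul_assoc]
  congr 1
  have himg : (fun τ ↦ Real.exp (N * τ)) '' univ = Ioi 0 := by
    ext r
    simp only [image_univ, mem_range, mem_Ioi]
    constructor
    · rintro ⟨τ, rfl⟩
      exact Real.exp_pos _
    · intro hr
      exact ⟨Real.log r / N, by rw [mul_div_cancel₀ _ hN.ne', Real.exp_log hr]⟩
  have hderiv : ∀ τ ∈ (univ : Set ℝ), HasDerivWithinAt (fun τ ↦ Real.exp (N * τ))
      (Real.exp (N * τ) * N) univ τ := by
    intro τ _
    have := ((hasDerivAt_id τ).const_mul N).exp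
    simpa using this
  have hinj : InjOn (fun τ ↦ Real.exp (N * τ)) univ := fun x _ y _ h ↦
    mul_left_cancel₀ hN.ne' (Real.exp_injective h)
  rw [← himg, lintegral_image_eq_lintegral_abs_deriv_mul MeasurableSet.univ hderiv hinj,
    setLIntegral_univ, ← lintegral_const_mul' _ _ ENNReal.ofReal_ne_top]
  refine lintegral_congr fun τ ↦ ?_
  have h0 := Real.exp_pos (N * τ)
  rw [abs_of_pos (by positivity), Real.log_exp, mul_div_cancel_left₀ _ hN.ne', ← mul_assoc,
    ← mul_assoc, ← ENNReal.ofReal_mul (by positivity), ← ENNReal.ofReal_mul (by positivity)]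
  congr 2
  rw [mul_assoc, ← Real.rpow_add h0]
  have : (d : ℝ) - 1 + -(d : ℝ) = -1 := by ring
  rw [this, Real.rpow_neg_one]
  field_simp

lemma hardyIntegral_testFunction (hd : 1 ≤ d) {s p q α β N : ℝ} (hq : 0 < q) (hN : 0 < N) :
    hardyIntegral d s p q α β
        (testFunction d (((d : ℝ) + α + q * β / p - s * q) / q) N) =
      sphereMass d * ENNReal.ofReal N * ∫⁻ τ, ENNReal.ofReal (cutoff τ) ^ q := by
  have := nontrivial_euclideanSpace hd
  generalize ha : ((d : ℝ) + α + q * β / p - s * q) / q = a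
  rw [← lintegral_log_norm hd hN (by fun_prop), hardyIntegral]
  refine lintegral_congr_ae ?_
  filter_upwards [Measure.ae_ne volume (0 : 𝔼)] with x hx
  have ht : 0 < ‖x‖ := norm_pos_iff.2 hx
  have hχ := cutoff_nonneg (Real.log ‖x‖ / N)
  rw [testFunction, ENNReal.ofReal_rpow_of_nonneg hχ hq.le,
    ← ENNReal.ofReal_mul (by positivity), abs_of_nonneg (by positivity),
    Real.mul_rpow (by positivity) hχ, ← Real.rpow_mul ht.le, mul_div_right_comm,
    ← Real.rpow_sub ht]
  congr 3
  rw [← ha]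
  field_simp
  ring

/-- The rescaled inner integral of the seminorm of a test function. -/
noncomputable def testProfile (d : ℕ) (σ p a β N : ℝ) (e : EuclideanSpace ℝ (Fin d)) (τ : ℝ) :
    ℝ≥0∞ :=
  ∫⁻ z : EuclideanSpace ℝ (Fin d),
    ENNReal.ofReal |cutoff τ - ‖z‖ ^ (-a) * cutoff (τ + Real.log ‖z‖ / N)| ^ p *
      unitKernel d σ β e z

lemma measurable_testProfile {σ p a β N : ℝ} {e : 𝔼} :
    Measurable (testProfile d σ p a β N e) := by
  unfold testProfile
  refine Measurable.lintegral_prod_right' (f := fun w : ℝ × 𝔼 ↦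
    ENNReal.ofReal |cutoff w.1 - ‖w.2‖ ^ (-a) * cutoff (w.1 + Real.log ‖w.2‖ / N)| ^ p *
      unitKernel d σ β e w.2) ?_
  exact Measurable.mul (by fun_prop) (measurable_unitKernel.comp measurable_snd)

lemma triebelLizorkin_testFunction (hd : 1 ≤ d) {s p q α β N : ℝ} (hp : 0 < p) (hq : 0 < q)
    (hN : 0 < N) {e : 𝔼} (he : ‖e‖ = 1) :
    triebelLizorkin d s p q α β
        (testFunction d (((d : ℝ) + α + q * β / p - s * q) / q) N) =
      sphereMass d * ENNReal.ofReal N *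
        ∫⁻ τ, testProfile d (s * p) p (((d : ℝ) + α + q * β / p - s * q) / q) β N e τ ^ (q / p) := by
  have := nontrivial_euclideanSpace hd
  generalize ha : ((d : ℝ) + α + q * β / p - s * q) / q = a
  rw [← lintegral_log_norm hd hN (measurable_testProfile.pow_const _)]
  change ∫⁻ x, seminormDensity d s p q α β (testFunction d a N) x = _
  refine lintegral_congr_ae ?_
  filter_upwards [Measure.ae_ne volume (0 : 𝔼)] with x hx
  have ht : 0 < ‖x‖ := norm_pos_iff.2 hx
  obtain ⟨g, hg⟩ := OrthGroup.exists_act_eq (x := ‖x‖ • e) (y := x) (by simp [norm_smul, he])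
  rw [g.act_smul] at hg
  have h1 := seminormDensity_eq (s := s) (α := α) (β := β) hp hq.le he ht g (testFunction d a N)
  rw [hg] at h1
  rw [h1]
  have h2 : ∫⁻ z, ENNReal.ofReal |testFunction d a N x - testFunction d a N (‖x‖ • g.act z)| ^ p *
      unitKernel d (s * p) β e z = ENNReal.ofReal (‖x‖ ^ (-a)) ^ p *
        testProfile d (s * p) p a β N e (Real.log ‖x‖ / N) := by
    rw [testProfile, ← lintegral_const_mul' _ _
      (ENNReal.rpow_ne_top_of_nonneg hp.le ENNReal.ofReal_ne_top)]
    refine lintegral_congr_ae ?_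
    filter_upwards [Measure.ae_ne volume (0 : 𝔼)] with z hz
    have hz' : 0 < ‖z‖ := norm_pos_iff.2 hz
    rw [← mul_assoc, ← ENNReal.mul_rpow_of_nonneg _ _ hp.le, ← ENNReal.ofReal_mul (by positivity)]
    congr 3
    rw [testFunction, testFunction, norm_smul, g.norm_act, norm_norm,
      Real.mul_rpow ht.le hz'.le, Real.log_mul ht.ne' hz'.ne', add_div, mul_assoc, ← mul_sub,
      abs_mul, abs_of_pos (Real.rpow_pos_of_pos ht _)]
  rw [h2, ENNReal.mul_rpow_of_nonneg _ _ (by positivity), ← ENNReal.rpow_mul,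
    mul_div_cancel₀ _ hp.ne', ← mul_assoc, ENNReal.ofReal_rpow_of_nonneg (by positivity) hq.le,
    ← Real.rpow_mul ht.le, ← ENNReal.ofReal_mul (by positivity), ← Real.rpow_add ht]
  congr 3
  rw [← ha]
  field_simp
  ring

lemma tendsto_lintegral_testProfile (hd : 1 ≤ d) {σ p q a β δ : ℝ} (hp : 0 < p) (hq : 0 < q)
    (hδ : 0 < δ) {e : 𝔼}
    (hD : ∫⁻ z : 𝔼, ENNReal.ofReal (dominator a δ ‖z‖) ^ p * unitKernel d σ β e z < ∞) :
    Tendsto (fun n : ℕ ↦ ∫⁻ τ, testProfile d σ p a β ((n : ℝ) + 1) e τ ^ (q / p)) atTop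
      (𝓝 (groundIntegral d σ p a β e ^ (q / p) * ∫⁻ τ, ENNReal.ofReal (cutoff τ) ^ q)) := by
  have := nontrivial_euclideanSpace hd
  obtain ⟨C, hC0, hC⟩ := exists_cutoff_difference_le a hδ.le
  set D := ∫⁻ z : 𝔼, ENNReal.ofReal (dominator a δ ‖z‖) ^ p * unitKernel d σ β e z with hDdef
  have hN : ∀ n : ℕ, (1 : ℝ) ≤ (n : ℝ) + 1 := fun n ↦ by linarith [n.cast_nonneg (α := ℝ)]
  have hfin : ∀ x : ℝ, ENNReal.ofReal x ^ p ≠ ∞ := fun x ↦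
    ENNReal.rpow_ne_top_of_nonneg hp.le ENNReal.ofReal_ne_top
  have hbd : ∀ (n : ℕ) (τ : ℝ), ∀ᵐ z : 𝔼,
      ENNReal.ofReal |cutoff τ - ‖z‖ ^ (-a) * cutoff (τ + Real.log ‖z‖ / ((n : ℝ) + 1))| ^ p *
        unitKernel d σ β e z ≤ ENNReal.ofReal (C * Real.exp (-(δ * |τ|))) ^ p *
        (ENNReal.ofReal (dominator a δ ‖z‖) ^ p * unitKernel d σ β e z) := by
    intro n τ
    filter_upwards [Measure.ae_ne volume (0 : 𝔼)] with z hz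
    rw [← mul_assoc, ← ENNReal.mul_rpow_of_nonneg _ _ hp.le, ← ENNReal.ofReal_mul (by positivity)]
    gcongr
    exact hC τ ‖z‖ _ (norm_pos_iff.2 hz) (hN n)
  have hinner : ∀ τ, Tendsto (fun n : ℕ ↦ testProfile d σ p a β ((n : ℝ) + 1) e τ) atTop
      (𝓝 (ENNReal.ofReal (cutoff τ) ^ p * groundIntegral d σ p a β e)) := by
    intro τ
    have hlim : ENNReal.ofReal (cutoff τ) ^ p * groundIntegral d σ p a β e =
        ∫⁻ z, ENNReal.ofReal |cutoff τ - ‖z‖ ^ (-a) * cutoff τ| ^ p * unitKernel d σ β e z := by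
      rw [groundIntegral, ← lintegral_const_mul' _ _ (hfin _)]
      refine lintegral_congr fun z ↦ ?_
      rw [← mul_assoc, ← ENNReal.mul_rpow_of_nonneg _ _ hp.le,
        ← ENNReal.ofReal_mul (cutoff_nonneg τ), ← one_sub_mul, abs_mul,
        abs_of_nonneg (cutoff_nonneg τ), mul_comm (cutoff τ)]
    rw [hlim]
    refine tendsto_lintegral_of_dominated_convergence _ (fun n ↦ ?_) (fun n ↦ hbd n τ) ?_ ?_
    · exact Measurable.mul (by fun_prop) measurable_unitKernel
    · rw [lintegral_const_mul' _ _ (hfin _)]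
      exact ENNReal.mul_ne_top (hfin _) hD.ne
    · refine Eventually.of_forall fun z ↦ ?_
      refine ENNReal.Tendsto.mul_const ?_ (Or.inr ENNReal.ofReal_ne_top)
      have h0 : Tendsto (fun n : ℕ ↦ Real.log ‖z‖ / ((n : ℝ) + 1)) atTop (𝓝 0) :=
        tendsto_const_nhds.div_atTop
          (tendsto_atTop_add_const_right _ _ tendsto_natCast_atTop_atTop)
      have h1 : Continuous fun h ↦
          ENNReal.ofReal |cutoff τ - ‖z‖ ^ (-a) * cutoff (τ + h)| ^ p := by
        refine ENNReal.continuous_rpow_const.comp (ENNReal.continuous_ofReal.comp ?_)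
        fun_prop
      have h2 := (h1.tendsto 0).comp h0
      rwa [add_zero] at h2
  have hval : groundIntegral d σ p a β e ^ (q / p) * ∫⁻ τ, ENNReal.ofReal (cutoff τ) ^ q =
      ∫⁻ τ, (ENNReal.ofReal (cutoff τ) ^ p * groundIntegral d σ p a β e) ^ (q / p) := by
    rw [← lintegral_const_mul _ (by fun_prop)]
    refine lintegral_congr fun τ ↦ ?_
    rw [ENNReal.mul_rpow_of_nonneg _ _ (by positivity), ← ENNReal.rpow_mul,
      mul_div_cancel₀ _ hp.ne', mul_comm]
  rw [hval]
  refine tendsto_lintegral_of_dominated_convergence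
    (fun τ ↦ D ^ (q / p) * ENNReal.ofReal C ^ q *
      ENNReal.ofReal (Real.exp (-(δ * q * |τ|)))) (fun n ↦ measurable_testProfile.pow_const _)
    (fun n ↦ Eventually.of_forall fun τ ↦ ?_) ?_ (Eventually.of_forall fun τ ↦ ?_)
  · have h1 : testProfile d σ p a β ((n : ℝ) + 1) e τ ≤
        ENNReal.ofReal (C * Real.exp (-(δ * |τ|))) ^ p * D := by
      rw [hDdef, ← lintegral_const_mul' _ _ (hfin _)]
      exact lintegral_mono_ae (hbd n τ)
    refine (ENNReal.rpow_le_rpow h1 (by positivity)).trans_eq ?_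
    rw [ENNReal.mul_rpow_of_nonneg _ _ (by positivity), ← ENNReal.rpow_mul,
      mul_div_cancel₀ _ hp.ne', ENNReal.ofReal_mul hC0, ENNReal.mul_rpow_of_nonneg _ _ hq.le,
      ENNReal.ofReal_rpow_of_nonneg (x := Real.exp _) (Real.exp_pos _).le hq.le, ← Real.exp_mul,
      mul_comm, ← mul_assoc]
    congr 3
    ring
  · have h2 : D ^ (q / p) * ENNReal.ofReal C ^ q ≠ ∞ :=
      ENNReal.mul_ne_top (ENNReal.rpow_ne_top_of_nonneg (by positivity) hD.ne)
        (ENNReal.rpow_ne_top_of_nonneg hq.le ENNReal.ofReal_ne_top)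
    rw [lintegral_const_mul' _ _ h2]
    exact ENNReal.mul_ne_top h2 (lintegral_exp_neg_abs_lt_top (by positivity)).ne
  · exact (ENNReal.continuous_rpow_const.tendsto _).comp (hinner τ)

lemma lintegral_cutoff_rpow_ne_zero (q : ℝ) :
    ∫⁻ τ, ENNReal.ofReal (cutoff τ) ^ q ≠ 0 := by
  have h : 1 ≤ ∫⁻ τ, ENNReal.ofReal (cutoff τ) ^ q := by
    calc (1 : ℝ≥0∞) = ∫⁻ _ in Icc (0 : ℝ) 1, 1 := by simp
      _ ≤ ∫⁻ τ in Icc (0 : ℝ) 1, ENNReal.ofReal (cutoff τ) ^ q := by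
        refine setLIntegral_mono' measurableSet_Icc fun τ hτ ↦ ?_
        rw [cutoff_eq_one (abs_le.2 ⟨by linarith [hτ.1], hτ.2⟩)]
        simp
      _ ≤ _ := setLIntegral_le_lintegral _ _
  exact (one_pos.trans_le h).ne'

lemma lintegral_cutoff_rpow_ne_top {q : ℝ} (hq : 0 < q) :
    ∫⁻ τ, ENNReal.ofReal (cutoff τ) ^ q ≠ ∞ := by
  have h : ∫⁻ τ, ENNReal.ofReal (cutoff τ) ^ q ≤ ∫⁻ _ in Icc (-2 : ℝ) 2, 1 := by
    rw [← lintegral_indicator measurableSet_Icc]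
    refine lintegral_mono fun τ ↦ ?_
    by_cases hτ : τ ∈ Icc (-2 : ℝ) 2
    · rw [indicator_of_mem hτ]
      exact ENNReal.rpow_le_one (ENNReal.ofReal_le_one.2 (cutoff_le_one τ)) hq.le
    · have h2 : 2 ≤ |τ| := by
        by_contra h
        exact hτ (abs_le.1 (by linarith))
      rw [cutoff_eq_zero h2, ENNReal.ofReal_zero, ENNReal.zero_rpow_of_pos hq]
      exact zero_le
  exact ne_top_of_le_ne_top (by simp) h

/-- A constant for which the inequality holds on all test functions is at most the ground one. -/
theorem le_groundIntegral_rpow_of_hardyInequality (hd : 1 ≤ d) {s p q α β δ : ℝ} (hp : 0 < p)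
    (hq : 0 < q) (hδ : 0 < δ) {e : 𝔼} (he : ‖e‖ = 1) {c : ℝ≥0∞}
    (ha : ((d : ℝ) + α + q * β / p - s * q) / q ≠ 0)
    (hD : ∫⁻ z : 𝔼, ENNReal.ofReal (dominator (((d : ℝ) + α + q * β / p - s * q) / q) δ ‖z‖) ^ p *
      unitKernel d (s * p) β e z < ∞)
    (hc : HardyInequality d s p q α β (CcOne d {0}ᶜ) c) :
    c ≤ groundIntegral d (s * p) p (((d : ℝ) + α + q * β / p - s * q) / q) β e ^ (q / p) := by
  have h1 : ∀ n : ℕ, c * ∫⁻ τ, ENNReal.ofReal (cutoff τ) ^ q ≤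
      ∫⁻ τ, testProfile d (s * p) p (((d : ℝ) + α + q * β / p - s * q) / q) β
        ((n : ℝ) + 1) e τ ^ (q / p) := by
    intro n
    have hN : 0 < (n : ℝ) + 1 := by positivity
    have h2 := hc _ (testFunction_mem_CcOne ha hN)
    rw [hardyIntegral_testFunction hd hq hN, triebelLizorkin_testFunction hd hp hq hN he,
      mul_left_comm] at h2
    refine (ENNReal.mul_le_mul_iff_right ?_ ?_).1 h2
    · exact mul_ne_zero (sphereMass_ne_zero hd) (ENNReal.ofReal_pos.2 hN).ne'
    · exact ENNReal.mul_ne_top sphereMass_ne_top ENNReal.ofReal_ne_top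
  have h3 := ge_of_tendsto' (tendsto_lintegral_testProfile hd hp hq hδ hD) h1
  exact (ENNReal.mul_le_mul_iff_left (lintegral_cutoff_rpow_ne_zero q)
    (lintegral_cutoff_rpow_ne_top hq)).1 h3

end TestFunctions

theorem theorem1 (d : ℕ) (hd : 1 ≤ d) (s p q α β : ℝ) (hs0 : 0 < s) (hs1 : s < 1)
    (hq : 1 ≤ q) (hqp : q ≤ p)
    (hα : α < s * q - (1 - q / p) * (d : ℝ)) (hβ : β < s * p)
    (hα' : -(d : ℝ) < α) (hβ' : -(d : ℝ) < β) (hαβ : -(d : ℝ) < α + q * β / p) :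
    hardyConst d s p q α β < ∞ ∧
    (s * q - α - q * β / p < (d : ℝ) →
      IsGreatest {c : ℝ≥0∞ | HardyInequality d s p q α β (CcOne d univ) c}
        (hardyConst d s p q α β)) ∧
    ((d : ℝ) < s * q - α - q * β / p →
      IsGreatest {c : ℝ≥0∞ | HardyInequality d s p q α β (CcOne d {0}ᶜ) c}
        (hardyConst d s p q α β)) := by
  have hq0 : 0 < q := by linarith
  have hp0 : 0 < p := by linarith
  have he : ‖EuclideanSpace.single (⟨0, hd⟩ : Fin d) (1 : ℝ)‖ = 1 := by simp
  rw [hardyConst_eq_groundIntegral_rpow hd hp0 hq0]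
  obtain ⟨δ, hδ, hD⟩ := exists_lintegral_dominator_lt_top hd hs0 hs1 hq hqp hα hβ hα' hβ' he
  have hI := groundIntegral_lt_top hd hp0.le hD
  refine ⟨ENNReal.rpow_lt_top_of_nonneg (by positivity) hI.ne, fun hγ ↦ ⟨fun u hu ↦ ?_, ?_⟩,
    fun hγ ↦ ⟨fun u hu ↦ ?_, ?_⟩⟩
  · exact groundIntegral_rpow_mul_hardyIntegral_le hd hq hqp he hu.1.continuous.measurable
      (hardyIntegral_lt_top hd hq0 hγ hu).ne hI.ne
  · intro c hc
    exact le_groundIntegral_rpow_of_hardyInequality hd hp0 hq0 hδ he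
      (div_ne_zero (by linarith) hq0.ne') hD fun u hu ↦ hc u ⟨hu.1, hu.2.1, subset_univ _⟩
  · exact groundIntegral_rpow_mul_hardyIntegral_le hd hq hqp he hu.1.continuous.measurable
      (hardyIntegral_lt_top_of_punctured hd hq0 hγ hu).ne hI.ne
  · intro c hc
    exact le_groundIntegral_rpow_of_hardyInequality hd hp0 hq0 hδ he
      (div_ne_zero (by linarith) hq0.ne') hD hc
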